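/- **Setting.** Let $d,T,D\ge 1$ and $\mathcal X_T=\{X=(x(1),\dots,x(T)) : x(t)\in[0,1]^d\}$. *Networks.* An $L$-layer feed-forward network is a composition of $L$ affine maps with a coordinatewise activation between consecutive ones; its width is the largest size of a hidden layer and its parameter count is the number of its nonzero weights and biases. *Transformers.* $\mathcal H(h,n,d,T,M)$ is the class of functions $$H(X)=\hat F\Bigl(\hat c_0+W_O\operatorname{Concat}_{i=1}^h\Bigl(\sum_{t=1}^T\sigma_i(t)\,W_{V,i}\,\hat x(t)\Bigr)\Bigr),\qquad \sigma_i(t)=\frac{\exp(\beta\,(W_{Q,i}\hat c_0)^\top W_{K,i}\hat x(t))}{\sum_{t'=1}^T\exp(\beta\,(W_{Q,i}\hat c_0)^\top W_{K,i}\hat x(t'))},$$ where $\hat x(t)=P_\phi(x(t),t)\in\mathbb R^{nh}$, $\beta>0$, $\hat c_0\in\mathbb R^{nh}$, and: the encoder $P_\phi$ is a two-layer network reading $x$ and the one-hot code of the position $t$, with $\|P_\phi(x,t)\|_2\le 1$ on $[0,1]^d\times[T]$; $W_{Q,i},W_{K,i},W_{V,i}\in\mathbb R^{n\times nh}$ and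 $W_O\in\mathbb R^{nh\times nh}$ have entries bounded by $1$ in magnitude; $\hat F:\mathbb R^{nh}\to\mathbb R$ is a two-layer network whose weights and biases are bounded by $1$ in magnitude; each of the two networks has some $1$-Lipschitz activation; and $P_\phi$ and $\hat F$ have together at most $M$ parameters. The class $\mathcal H$ $\epsilon$-approximates a set $\mathcal F$ of functions if for every $F\in\mathcal F$ there is $H\in\mathcal H$ with $\sup_{X\in\mathcal X_T}|H(X)-F(X)|<\epsilon$. *Targets.* $\mathcal F_D^{d,T}$ is the set of functions $X\mapsto F_0(\bar z_1(X),\dots,\bar z_D(X))$, $\bar z_i(X)=\min_{t\in S_i}f_i(x(t))$, where $S_i\subseteq[T]$ with $|S_i|\ge T/4$, $F_0:[0,1]^D\to\mathbb R$ is $C^1$, each $f_i:[0,1]^d\to[0,1]$ is $C^2$ with a unique global minimizer $x^{(i)}$ and a positive definite Hessian there, the points $x^{(i)}$ are pairwise distinct, and all partial derivatives of $F_0$ at $(f_1(x^{(1)}),\dots,f_D(x^{(D)}))$ are nonzero (derivatives at boundary points are taken within the cube). *Approximation assumption.* For constants $C_1,\gamma_1,C_2,\gamma_2>0$ and $\Lambda\ge0$,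 let $\mathcal F_D^{d,T}(C_1,\gamma_1,C_2,\gamma_2,\Lambda)$ be the set of those targets in $\mathcal F_D^{d,T}$ that have components $F_0,f_i,S_i$ as above such that $F_0$ is $\Lambda$-Lipschitz in the sup norm and, for every $\delta>0$, $F_0$ is uniformly $\delta$-approximated on $[0,1]^D$ by a two-layer network with $1$-Lipschitz activation, weights and biases bounded by $1$ and width at most $C_1/\delta^{\gamma_1}$, and each $f_i$ is uniformly $\delta$-approximated on $[0,1]^d$ by a two-layer network with $1$-Lipschitz activation and width at most $C_2/\delta^{\gamma_2}$. Let $\mathcal F_{D,\mathrm{ReLU}}^{d,T}(C_1,\gamma_1,C_2,\gamma_2,\Lambda)$ be defined in the same way, with all these networks being ReLU networks with weights and biases bounded by $1$. Put $\gamma=\max(\gamma_1,\gamma_2)$. **Theorem.** (1) ($D$ heads.) For all $C_1,\gamma_1,C_2,\gamma_2>0$ and $\Lambda\ge0$ there is $C>0$, depending only on $d,D,T,C_1,\gamma_1,C_2,\gamma_2,\Lambda$, such that for all $\epsilon>0$ and all integers $M>C/\epsilon^{\gamma}$ the class $\mathcal H(D,2,d,T,M)$ (that is, $h=D$ heads of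 dimension $n=2$) $\epsilon$-approximates $\mathcal F_D^{d,T}(C_1,\gamma_1,C_2,\gamma_2,\Lambda)$. In particular the exponent does not depend on $T$. (2) (Fewer than $D$ heads.) Let $1\le s<D$, $n\ge1$ and $$k=\frac{\frac14T-s-D+1}{(n+1)s+1}-1 .$$ For every nonempty $\mathcal F\subseteq\mathcal F_D^{d,T}$ (in particular for a single target), $$\min\{M\ge1:\ \mathcal H(s,n,d,T,M)\ \epsilon\text{-approximates }\mathcal F\}=\Omega(1/\epsilon^k)\qquad(\epsilon\to0),$$ where the minimum of the empty set is $+\infty$. The same bound, with the same constants, holds when the encoder $P_\phi$ may have any number of layers. (3) (One head, large embedding dimension.) Let $\mathcal H'(1,n,d,T,M)$ be defined like $\mathcal H(1,n,d,T,M)$, but with a five-layer ReLU feed-forward block $\hat F$ (weights and biases still bounded by $1$) and a two-layer ReLU encoder. For all $C_1,\gamma_1,C_2,\gamma_2>0$ and $\Lambda\ge0$ there is $C>0$, depending only on $d,D,T,C_1,\gamma_1,C_2,\gamma_2,\Lambda$, such that for all $n\ge Td$, all $\epsilon>0$ and all integers $M>C/\epsilon^{1+\gamma}$ the class $\mathcal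 H'(1,n,d,T,M)$ $\epsilon$-approximates $\mathcal F_{D,\mathrm{ReLU}}^{d,T}(C_1,\gamma_1,C_2,\gamma_2,\Lambda)$. -/

import Mathlib

open scoped NNReal Matrix

noncomputable section

namespace TransformerRates

/-! ### Feed-forward networks -/

/-- `FFN l L m` is the type of fully connected feed-forward networks with `L` layers, input
dimension `m` and output dimension `l`. An `L`-layer network consists of `L` affine maps; the
activation is applied coordinatewise after each of them except the last one, so there are `L - 1`
hidden layers. -/
inductive FFN (l : ℕ) : ℕ → ℕ → Type
  | output {m : ℕ} (A : Matrix (Fin l) (Fin m) ℝ) (b : Fin l → ℝ) : FFN l 1 m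
  | layer {L m p : ℕ} (A : Matrix (Fin p) (Fin m) ℝ) (b : Fin p → ℝ) (N : FFN l L p) :
      FFN l (L + 1) m

/-- The function computed by a network with activation `σ`. -/
def FFN.eval (σ : ℝ → ℝ) {l : ℕ} : {L m : ℕ} → FFN l L m → (Fin m → ℝ) → (Fin l → ℝ)
  | _, _, .output A b, x => A *ᵥ x + b
  | _, _, .layer A b N, x => N.eval σ (fun r => σ ((A *ᵥ x + b) r))

/-- The number of nonzero entries of a weight matrix and a bias vector. -/
def nonzeroCount {p m : ℕ} (A : Matrix (Fin p) (Fin m) ℝ) (b : Fin p → ℝ) : ℕ :=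
  Set.ncard {q : Fin p × Fin m | A q.1 q.2 ≠ 0} + Set.ncard {r : Fin p | b r ≠ 0}

/-- The parameter count of a network: the number of its nonzero weights and biases. -/
def FFN.paramCount {l : ℕ} : {L m : ℕ} → FFN l L m → ℕ
  | _, _, .output A b => nonzeroCount A b
  | _, _, .layer A b N => nonzeroCount A b + N.paramCount

/-- The width of a network: the largest number of units in a hidden layer. -/
def FFN.width {l : ℕ} : {L m : ℕ} → FFN l L m → ℕ
  | _, _, .output _ _ => 0
  | _, _, .layer (p := p) _ _ N => max p N.width

/-- All weights and biases of the network lie in `W`. -/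
def FFN.WeightsIn (W : Set ℝ) {l : ℕ} : {L m : ℕ} → FFN l L m → Prop
  | _, _, .output A b => (∀ r j, A r j ∈ W) ∧ ∀ r, b r ∈ W
  | _, _, .layer A b N => ((∀ r j, A r j ∈ W) ∧ ∀ r, b r ∈ W) ∧ N.WeightsIn W

/-- The weights bounded in magnitude by `1`. -/
def unitWeights : Set ℝ := Set.Icc (-1) 1

/-- The `1`-Lipschitz activations. -/
def lipschitzActivations : Set (ℝ → ℝ) := {σ | LipschitzWith 1 σ}

/-- The ReLU activation. -/
def relu (u : ℝ) : ℝ := max u 0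

/-- The cube `[0,1]^m`. -/
def cube (m : ℕ) : Set (Fin m → ℝ) := Set.Icc 0 1

/-- For every `δ > 0`, the function `g` is uniformly `δ`-approximated on `[0,1]^m` by a two-layer
network of width at most `C / δ ^ γ` with weights in `W` and an activation in `𝒜`. -/
def ApproxAtRate (𝒜 : Set (ℝ → ℝ)) (W : Set ℝ) (C γ : ℝ) {m : ℕ} (g : (Fin m → ℝ) → ℝ) : Prop :=
  ∀ δ : ℝ, 0 < δ → ∃ σ ∈ 𝒜, ∃ N : FFN 1 2 m,
    N.WeightsIn W ∧ (N.width : ℝ) ≤ C / δ ^ γ ∧ ∀ x ∈ cube m, |g x - N.eval σ x 0| ≤ δ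

/-! ### Single-layer transformers -/

/-- The input space `𝒳_T`: sequences of `T` tokens in `[0,1]^d`. -/
def inputSpace (d T : ℕ) : Set (Fin T → Fin d → ℝ) := {X | ∀ t, X t ∈ cube d}

/-- The softmax of the scores `ρ` with scaling factor `β`. -/
def softmax (β : ℝ) {T : ℕ} (ρ : Fin T → ℝ) (t : Fin T) : ℝ :=
  Real.exp (β * ρ t) / ∑ t', Real.exp (β * ρ t')

/-- The attention layer with `h` heads of dimension `n` (total embedding dimension `E = h * n`),
together with the classification token `c₀` and the softmax scaling factor `β`. -/
structure Attention (h n : ℕ) where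
  WQ : Fin h → Matrix (Fin n) (Fin (h * n)) ℝ
  WK : Fin h → Matrix (Fin n) (Fin (h * n)) ℝ
  WV : Fin h → Matrix (Fin n) (Fin (h * n)) ℝ
  WO : Matrix (Fin (h * n)) (Fin (h * n)) ℝ
  c₀ : Fin (h * n) → ℝ
  β : ℝ

namespace Attention

variable {h n : ℕ}

/-- The softmax scaling factor is positive and the entries of all projection matrices are bounded in
magnitude by `1`. -/
def Admissible (a : Attention h n) : Prop :=
  0 < a.β ∧
  (∀ i r j, |a.WQ i r j| ≤ 1) ∧ (∀ i r j, |a.WK i r j| ≤ 1) ∧ (∀ i r j, |a.WV i r j| ≤ 1) ∧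
  ∀ r j, |a.WO r j| ≤ 1

/-- The output of head `i` on the embedded tokens `e`. -/
def head (a : Attention h n) {T : ℕ} (e : Fin T → Fin (h * n) → ℝ) (i : Fin h) : Fin n → ℝ :=
  ∑ t, softmax a.β (fun t' => (a.WQ i *ᵥ a.c₀) ⬝ᵥ (a.WK i *ᵥ e t')) t • (a.WV i *ᵥ e t)

/-- The concatenation of the head outputs. -/
def concatHeads (a : Attention h n) {T : ℕ} (e : Fin T → Fin (h * n) → ℝ) : Fin (h * n) → ℝ :=
  fun q => a.head e (finProdFinEquiv.symm q).1 (finProdFinEquiv.symm q).2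

/-- The vector at the position of the classification token after the attention layer. -/
def out (a : Attention h n) {T : ℕ} (e : Fin T → Fin (h * n) → ℝ) : Fin (h * n) → ℝ :=
  a.c₀ + a.WO *ᵥ a.concatHeads e

end Attention

/-- The encoder `P_φ : [0,1]^d × [T] → ℝ^E` given by a network that reads the token `x` together with
the one-hot code of its position `t`. -/
def encode (σ : ℝ → ℝ) {E ℓ d T : ℕ} (P : FFN E ℓ (d + T)) (x : Fin d → ℝ) (t : Fin T) : Fin E → ℝ :=
  P.eval σ (Fin.append x (Pi.single t 1))

/-- The hypothesis class `ℋ(h, n, d, T, M)` of single-layer transformers `H : [0,1]^{d × T} → ℝ` with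
`h` heads, per-head dimension `n` and at most `M` parameters in the encoder `P_φ` and the
feed-forward block `G`. The encoder is an `ℓ`-layer network with `‖P_φ(x, t)‖₂ ≤ 1`, the feed-forward
block is an `L`-layer network with weights bounded by `1`, the attention matrices have entries
bounded by `1`, and the activations of the two networks belong to `𝒜`. -/
def hypothesisClass (𝒜 : Set (ℝ → ℝ)) (ℓ L h n d T M : ℕ) : Set ((Fin T → Fin d → ℝ) → ℝ) :=
  {H | ∃ σ ∈ 𝒜, ∃ τ ∈ 𝒜, ∃ (P : FFN (h * n) ℓ (d + T)) (a : Attention h n) (G : FFN 1 L (h * n)),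
    (∀ x ∈ cube d, ∀ t : Fin T, √(∑ q, encode σ P x t q ^ 2) ≤ 1) ∧
    a.Admissible ∧
    G.WeightsIn unitWeights ∧
    P.paramCount + G.paramCount ≤ M ∧
    H = fun X => G.eval τ (a.out fun t => encode σ P (X t) t) 0}

/-- The hypothesis class `ℋ` `ε`-approximates every function of the class `𝓕`: for each `F ∈ 𝓕`
there is `H ∈ ℋ` with `sup_{X ∈ 𝒳_T} |H X - F X| < ε`. -/
def EpsApproximates {d T : ℕ} (ℋ : Set ((Fin T → Fin d → ℝ) → ℝ)) (ε : ℝ)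
    (𝓕 : Set ((Fin T → Fin d → ℝ) → ℝ)) : Prop :=
  ∀ F ∈ 𝓕, ∃ H ∈ ℋ, ∃ η < ε, ∀ X ∈ inputSpace d T, |H X - F X| ≤ η

/-! ### Generalized `D`-retrieval tasks -/

/-- The target `X ↦ F₀ (z̄₁(X), …, z̄_D(X))` with `z̄ᵢ(X) = min_{t ∈ Sᵢ} fᵢ(x(t))`. -/
def retrievalTarget {d T D : ℕ} (F₀ : (Fin D → ℝ) → ℝ) (f : Fin D → (Fin d → ℝ) → ℝ)
    (S : Fin D → Finset (Fin T)) (X : Fin T → Fin d → ℝ) : ℝ :=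
  F₀ fun i => ⨅ t : {t // t ∈ S i}, f i (X t)

/-- The conditions on the components `F₀`, `fᵢ`, `Sᵢ` of a generalized `D`-retrieval task, with
minimizers `xmin i`. Derivatives at boundary points are taken within the cube. -/
structure IsRetrievalTask {d T D : ℕ} (F₀ : (Fin D → ℝ) → ℝ) (f : Fin D → (Fin d → ℝ) → ℝ)
    (S : Fin D → Finset (Fin T)) (xmin : Fin D → Fin d → ℝ) : Prop where
  contDiffOn_outer : ContDiffOn ℝ 1 F₀ (cube D)
  contDiffOn_comp : ∀ i, ContDiffOn ℝ 2 (f i) (cube d)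
  mapsTo_comp : ∀ i, Set.MapsTo (f i) (cube d) (Set.Icc 0 1)
  quarter_le_card : ∀ i, (T : ℝ) / 4 ≤ (S i).card
  xmin_mem : ∀ i, xmin i ∈ cube d
  unique_min : ∀ i, ∀ y ∈ cube d, y ≠ xmin i → f i (xmin i) < f i y
  xmin_injective : Function.Injective xmin
  hessian_posDef : ∀ i, ∀ v : Fin d → ℝ, v ≠ 0 →
    0 < iteratedFDerivWithin ℝ 2 (f i) (cube d) (xmin i) ![v, v]
  partial_ne_zero : ∀ i : Fin D,
    fderivWithin ℝ F₀ (cube D) (fun j => f j (xmin j)) (Pi.single i 1) ≠ 0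

/-- The target class `ℱ_D^{d,T}`. -/
def targetClass (d T D : ℕ) : Set ((Fin T → Fin d → ℝ) → ℝ) :=
  {H | ∃ F₀ f S xmin, IsRetrievalTask (d := d) (T := T) (D := D) F₀ f S xmin ∧
    H = retrievalTarget F₀ f S}

/-- The functions of the class `ℱ_D^{d,T}` whose components satisfy the approximation assumptions
with given constants: `F₀` is approximated at rate `(C₁, γ₁)` by networks with weights bounded by
`1`, each `fᵢ` at rate `(C₂, γ₂)` by networks with weights in `W`, all with activations in `𝒜`, and
`Λ` is a Lipschitz constant of `F₀` on the cube. -/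
def approxTargetClass (𝒜 : Set (ℝ → ℝ)) (W : Set ℝ) (d T D : ℕ) (C₁ γ₁ C₂ γ₂ : ℝ) (Λ : ℝ≥0) :
    Set ((Fin T → Fin d → ℝ) → ℝ) :=
  {H | ∃ F₀ f S xmin, IsRetrievalTask (d := d) (T := T) (D := D) F₀ f S xmin ∧
    LipschitzOnWith Λ F₀ (cube D) ∧
    ApproxAtRate 𝒜 unitWeights C₁ γ₁ F₀ ∧
    (∀ i, ApproxAtRate 𝒜 W C₂ γ₂ (f i)) ∧
    H = retrievalTarget F₀ f S}

end TransformerRates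

end

namespace TransformerRates

/-! ### Building networks with arbitrary finite index types -/

/-! Upper bound with `D` heads. A head is a softmax average. If its score is minus the sum of an
approximation of `f i` and a penalty outside `S i`, the average is a soft minimum with error at most
`T / β` (`abs_softmin_sub_le`). Since `β` is free, this precision costs no parameters: up to
constants depending on `d`, `D`, `T`, the parameters are those of the networks for `F₀` and the `f
i`, which gives the exponent `γ`. Different activations are merged into one by
`exists_common_activation`. The norm bound on the encoder is met by shrinking the embedding; a
larger `β` and repeated hidden units undo the shrinking.

Upper bound with one wide head. Each position owns a block of coordinates, so plain averaging passes
the whole sequence to the feed-forward block. That block computes the minima with about `1 / ε`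
thresholds (`reluMin`, `abs_reluMin_sub_le`), which multiply the parameter count and turn `γ` into
`1 + γ`.

Lower bound. For each of the `s` heads one can fix a token at some position whose score is at least
that of every candidate token at the free positions (`exists_dominating`). After dividing by the
exponential of that score, the free positions influence a head only through `n + 1` bounded sums:
the normalizer and `n` numerators. As `s < D`, some component `i₁` is attached to none of the fixed
tokens. Further positions are set to the minimizers of the other components, and at least `T / 4 - s
- D + 1` positions of `S i₁` stay free. With `q` levels of `f i₁` per free position, about `1 / ε`
in number, there are more configurations than cells in the box of the `s (n + 1)` sums, so two
configurations have nearly equal sums (`exists_ne_close`). All levels are distinct, so the two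
minima, and hence the two target values, differ by a multiple of `ε` (`exists_confused_inputs`).
Only the feed-forward block can separate the two inputs, and its Lipschitz constant is at most its
parameter count (`FFN.abs_eval_sub_le`). The encoder enters only through its boundedness, so its
depth is irrelevant. -/

/-- Some `L`-layer network with weights in `W` and at most `c` parameters computes `g`, whichever
enumeration of the input coordinates is used. -/
def Realizes (σ : ℝ → ℝ) (W : Set ℝ) {l : ℕ} (L c : ℕ) {ι : Type} (g : (ι → ℝ) → Fin l → ℝ) : Prop :=
  ∀ (m : ℕ) (e : ι ≃ Fin m), ∃ N : FFN l L m, N.WeightsIn W ∧ N.paramCount ≤ c ∧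
    ∀ x : Fin m → ℝ, N.eval σ x = g fun i => x (e i)

/-- The number of nonzero entries of an array of weights and a family of biases. -/
noncomputable def entryCount {κ ι : Type} (A : κ → ι → ℝ) (b : κ → ℝ) : ℕ :=
  Set.ncard {q : κ × ι | A q.1 q.2 ≠ 0} + Set.ncard {r : κ | b r ≠ 0}

lemma nonzeroCount_reindex {κ ι : Type} {p m : ℕ} (A : κ → ι → ℝ) (b : κ → ℝ) (e : ι ≃ Fin m)
    (f : κ ≃ Fin p) :
    nonzeroCount (Matrix.of fun r j => A (f.symm r) (e.symm j)) (fun r => b (f.symm r)) =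
      entryCount A b := by
  unfold nonzeroCount entryCount
  congr 1
  · refine (Set.ncard_congr (fun q _ => (f q.1, e q.2)) ?_ ?_ ?_).symm
    · rintro ⟨r, j⟩ h
      simpa using h
    · rintro ⟨r, j⟩ ⟨r', j'⟩ _ _ h
      simpa using h
    · rintro ⟨r, j⟩ h
      exact ⟨(f.symm r, e.symm j), by simpa using h, by simp⟩
  · refine (Set.ncard_congr (fun q _ => f q) ?_ ?_ ?_).symm
    · intro r h
      simpa using h
    · intro r r' _ _ h
      simpa using h
    · intro r h
      exact ⟨f.symm r, by simpa using h, by simp⟩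

lemma Realizes.output {σ : ℝ → ℝ} {W : Set ℝ} {l c : ℕ} {ι : Type} [Fintype ι]
    (A : Fin l → ι → ℝ) (b : Fin l → ℝ) (hA : ∀ r j, A r j ∈ W) (hb : ∀ r, b r ∈ W)
    (hc : entryCount A b ≤ c) :
    Realizes σ W 1 c fun x r => ∑ j, A r j * x j + b r := by
  intro m e
  refine ⟨.output (Matrix.of fun r j => A r (e.symm j)) b, ⟨fun r j => hA _ _, hb⟩, ?_, ?_⟩
  · rw [← nonzeroCount_reindex A b e (Equiv.refl _)] at hc
    exact hc
  · intro x
    ext r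
    simp only [FFN.eval, Pi.add_apply, Matrix.mulVec, dotProduct, Matrix.of_apply]
    congr 1
    exact Fintype.sum_equiv e.symm _ _ (by simp)

lemma Realizes.layer {σ : ℝ → ℝ} {W : Set ℝ} {l L c c' : ℕ} {ι κ : Type} [Fintype ι] [Fintype κ]
    {g : (κ → ℝ) → Fin l → ℝ}
    (A : κ → ι → ℝ) (b : κ → ℝ) (hA : ∀ r j, A r j ∈ W) (hb : ∀ r, b r ∈ W)
    (hc : entryCount A b ≤ c) (h : Realizes σ W L c' g) :
    Realizes σ W (L + 1) (c + c') fun x => g fun r => σ (∑ j, A r j * x j + b r) := by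
  intro m e
  obtain ⟨N, hW, hN, hev⟩ := h _ (Fintype.equivFin κ)
  set f := Fintype.equivFin κ
  refine ⟨.layer (Matrix.of fun r j => A (f.symm r) (e.symm j)) (fun r => b (f.symm r)) N,
    ⟨⟨fun r j => hA _ _, fun r => hb _⟩, hW⟩, ?_, ?_⟩
  · rw [← nonzeroCount_reindex A b e f] at hc
    exact add_le_add hc hN
  · intro x
    simp only [FFN.eval, hev]
    congr 1
    ext r
    simp only [Pi.add_apply, Matrix.mulVec, dotProduct, Matrix.of_apply, Equiv.symm_apply_apply]
    congr 2
    exact Fintype.sum_equiv e.symm _ _ (by simp)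

lemma ncard_le_card_of_subset_range {α β : Type*} [Fintype α] {s : Set β} (f : α → β)
    (h : s ⊆ Set.range f) : s.ncard ≤ Fintype.card α := by
  refine (Set.ncard_le_ncard h (Set.finite_range f)).trans ?_
  rw [← Set.image_univ]
  refine (Set.ncard_image_le Set.finite_univ).trans ?_
  rw [Set.ncard_univ, Nat.card_eq_fintype_card]

lemma entryCount_le {κ ι : Type} [Fintype κ] [Fintype ι] (A : κ → ι → ℝ) (b : κ → ℝ) :
    entryCount A b ≤ Fintype.card κ * Fintype.card ι + Fintype.card κ := by
  rw [← Fintype.card_prod]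
  exact add_le_add (ncard_le_card_of_subset_range id (by simp))
    (ncard_le_card_of_subset_range id (by simp))

/-! ### Two-layer networks in coordinates, the zero transformer, and large `ε`. -/

/-- A two-layer network with a scalar output, in coordinates. -/
noncomputable def shallow (σ : ℝ → ℝ) {p m : ℕ} (A : Fin p → Fin m → ℝ) (b a : Fin p → ℝ) (c : ℝ)
    (x : Fin m → ℝ) : ℝ :=
  ∑ r, a r * σ (∑ j, A r j * x j + b r) + c

lemma FFN.exists_eq_layer_output {l m : ℕ} (N : FFN l 2 m) :
    ∃ (p : ℕ) (A : Matrix (Fin p) (Fin m) ℝ) (b : Fin p → ℝ) (A' : Matrix (Fin l) (Fin p) ℝ)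
      (b' : Fin l → ℝ), N = .layer A b (.output A' b') := by
  cases N with
  | layer A b N' =>
    cases N' with
    | output A' b' => exact ⟨_, A, b, A', b', rfl⟩
    | layer _ _ N'' => cases N''

lemma ApproxAtRate.exists_shallow {𝒜 : Set (ℝ → ℝ)} {W : Set ℝ} {C γ : ℝ} {m : ℕ}
    {g : (Fin m → ℝ) → ℝ} (h : ApproxAtRate 𝒜 W C γ g) {δ : ℝ} (hδ : 0 < δ) :
    ∃ σ ∈ 𝒜, ∃ (p : ℕ) (A : Fin p → Fin m → ℝ) (b a : Fin p → ℝ) (c : ℝ),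
      (∀ r j, A r j ∈ W) ∧ (∀ r, b r ∈ W) ∧ (∀ r, a r ∈ W) ∧ c ∈ W ∧ (p : ℝ) ≤ C / δ ^ γ ∧
      ∀ x ∈ cube m, |g x - shallow σ A b a c x| ≤ δ := by
  obtain ⟨σ, hσ, N, hW, hN, happ⟩ := h δ hδ
  obtain ⟨p, A, b, A', b', rfl⟩ := N.exists_eq_layer_output
  obtain ⟨⟨hA, hb⟩, hA', hb'⟩ := hW
  refine ⟨σ, hσ, p, A, b, A' 0, b' 0, hA, hb, hA' 0, hb' 0, ?_, fun x hx => ?_⟩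
  · simpa [FFN.width] using hN
  · simpa [FFN.eval, shallow, Matrix.mulVec, dotProduct] using happ x hx

/-- The network with empty hidden layers and vanishing output. -/
noncomputable def FFN.trivial (l : ℕ) : (L m : ℕ) → FFN l (L + 1) m
  | 0, _ => .output 0 0
  | L + 1, _ => .layer (p := 0) 0 0 (FFN.trivial l L 0)

lemma FFN.trivial_eval (σ : ℝ → ℝ) (l L m : ℕ) (x : Fin m → ℝ) :
    (FFN.trivial l L m).eval σ x = 0 := by
  induction L generalizing m with
  | zero => simp [FFN.trivial, FFN.eval]
  | succ L ih => simp [FFN.trivial, FFN.eval, ih]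

lemma FFN.trivial_paramCount (l L m : ℕ) : (FFN.trivial l L m).paramCount = 0 := by
  induction L generalizing m with
  | zero => simp [FFN.trivial, FFN.paramCount, nonzeroCount]
  | succ L ih =>
    have h : {r : Fin 0 | (0 : Fin 0 → ℝ) r ≠ 0} = ∅ := Set.eq_empty_of_isEmpty _
    have h' : {q : Fin 0 × Fin m | (0 : Matrix (Fin 0) (Fin m) ℝ) q.1 q.2 ≠ 0} = ∅ :=
      Set.eq_empty_of_isEmpty _
    rw [FFN.trivial, FFN.paramCount, ih, nonzeroCount, h, h']
    simp

lemma FFN.trivial_weightsIn (l L m : ℕ) : (FFN.trivial l L m).WeightsIn unitWeights := by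
  induction L generalizing m with
  | zero => simp [FFN.trivial, FFN.WeightsIn, unitWeights]
  | succ L ih => exact ⟨⟨fun r => r.elim0, fun r => r.elim0⟩, ih 0⟩

lemma zero_mem_hypothesisClass {𝒜 : Set (ℝ → ℝ)} (h𝒜 : 𝒜.Nonempty) (ℓ L h n d T M : ℕ) :
    (fun _ => 0) ∈ hypothesisClass 𝒜 (ℓ + 1) (L + 1) h n d T M := by
  obtain ⟨σ, hσ⟩ := h𝒜
  refine ⟨σ, hσ, σ, hσ, FFN.trivial _ _ _, ⟨0, 0, 0, 0, 0, 1⟩, FFN.trivial _ _ _, ?_, ?_,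
    FFN.trivial_weightsIn _ _ _, ?_, ?_⟩
  · simp [encode, FFN.trivial_eval]
  · simp [Attention.Admissible]
  · simp [FFN.trivial_paramCount]
  · simp [FFN.trivial_eval]

/-- Functions approximated at a polynomial rate by networks with bounded weights are bounded. -/
lemma ApproxAtRate.abs_le {𝒜 : Set (ℝ → ℝ)} {C γ : ℝ} (hC : 0 < C) (hγ : 0 < γ) {m : ℕ}
    {g : (Fin m → ℝ) → ℝ} (h : ApproxAtRate 𝒜 unitWeights C γ g) :
    ∀ x ∈ cube m, |g x| ≤ 1 + (C + 1) ^ (1 / γ) := by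
  intro x hx
  have hpos : 0 < (C + 1) ^ (1 / γ) := by positivity
  -- At this accuracy the admissible width is at most `C / (C + 1) < 1`, so the network has no
  -- hidden unit and is a constant in `[-1, 1]`.
  obtain ⟨σ, -, p, A, b, a, c, -, -, -, hc, hp, happ⟩ := h.exists_shallow hpos
  have h1 : ((C + 1) ^ (1 / γ)) ^ γ = C + 1 := by
    rw [← Real.rpow_mul (by positivity), one_div_mul_cancel hγ.ne', Real.rpow_one]
  rw [h1] at hp
  have : (p : ℝ) < 1 := hp.trans_lt (by rw [div_lt_one (by positivity)]; linarith)
  have hp0 : p = 0 := by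
    have : p < 1 := by exact_mod_cast this
    omega
  subst hp0
  have := happ x hx
  simp only [shallow, Finset.univ_eq_empty, Finset.sum_empty, zero_add] at this
  have hc' : |c| ≤ 1 := _root_.abs_le.2 hc
  have := abs_sub_abs_le_abs_sub (g x) c
  linarith

/-- Comparison of powers of `1 / ε` on a bounded range of `ε`. -/
lemma exists_div_rpow_le {C k R γ g : ℝ} (hC : 0 ≤ C) (hk : 0 < k) (hR : 0 < R) (hγ : γ ≤ g) :
    ∃ C' : ℝ, 0 ≤ C' ∧ ∀ ε : ℝ, 0 < ε → ε ≤ R → C / (ε / k) ^ γ ≤ C' / ε ^ g := by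
  refine ⟨C * k ^ γ * R ^ (g - γ), by positivity, fun ε hε hεR => ?_⟩
  have h1 : ε ^ (g - γ) ≤ R ^ (g - γ) := Real.rpow_le_rpow hε.le hεR (by linarith)
  have h2 : ε ^ g = ε ^ γ * ε ^ (g - γ) := by rw [← Real.rpow_add hε]; ring_nf
  rw [Real.div_rpow hε.le hk.le, h2, div_div_eq_mul_div, div_le_div_iff₀ (by positivity)
    (by positivity)]
  calc C * k ^ γ * (ε ^ γ * ε ^ (g - γ)) ≤ C * k ^ γ * (ε ^ γ * R ^ (g - γ)) := by gcongr
    _ = _ := by ring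


/-! ### `D` heads of dimension two -/

/-- A map into the reals that does not expand distances measured through `φ` factors through a
`1`-Lipschitz function of `φ`. -/
lemma exists_lipschitz_factor {α : Type*} (φ ψ : α → ℝ) (h : ∀ a b, |ψ a - ψ b| ≤ |φ a - φ b|) :
    ∃ τ : ℝ → ℝ, LipschitzWith 1 τ ∧ ∀ a, τ (φ a) = ψ a := by
  classical
  have hfac : ∀ a : α, Function.extend φ ψ (fun _ => (0 : ℝ)) (φ a) = ψ a := by
    refine fun a => Function.FactorsThrough.extend_apply (fun a b hab => ?_) _ a
    have := h a b
    rw [hab, sub_self, abs_zero] at this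
    exact sub_eq_zero.1 (abs_nonpos_iff.1 this)
  have hL : LipschitzOnWith 1 (Function.extend φ ψ fun _ => (0 : ℝ)) (Set.range φ) := by
    refine LipschitzOnWith.of_dist_le_mul ?_
    rintro _ ⟨a, rfl⟩ _ ⟨b, rfl⟩
    simpa [hfac, Real.dist_eq] using h a b
  obtain ⟨τ, hτ, heq⟩ := hL.extend_real
  exact ⟨τ, hτ, fun a => by rw [← heq ⟨a, rfl⟩, hfac]⟩

lemma abs_sub_le_of_lipschitz {σ : ℝ → ℝ} (h : LipschitzWith 1 σ) (x y : ℝ) :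
    |σ x - σ y| ≤ |x - y| := by
  simpa [Real.dist_eq] using h.dist_le_mul x y

/-- Finitely many `1`-Lipschitz activations can be simulated, on a bounded range of arguments, by
translates of a single one. -/
lemma exists_common_activation {ι : Type} [Fintype ι] (σ : ι → ℝ → ℝ)
    (hσ : ∀ i, LipschitzWith 1 (σ i)) (B : ℝ) :
    ∃ (τ : ℝ → ℝ) (s : ι → ℝ), LipschitzWith 1 τ ∧
      ∀ i u, |u| ≤ B → τ (u + s i) = σ i u - σ i 0 := by
  classical
  -- The windows of radius `B` around the shifts are at distance at least `2 * B`, while the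
  -- normalized values lie in `[-B, B]`. Hence the function pieced together from the windows is
  -- 1-Lipschitz across gaps as well and extends to the line.
  let s : ι → ℝ := fun i => 4 * B * (Fintype.equivFin ι i : ℕ)
  obtain ⟨τ, hτ, h⟩ := exists_lipschitz_factor (α := ι × {u : ℝ // |u| ≤ B})
    (fun a => a.2.1 + s a.1) (fun a => σ a.1 a.2.1 - σ a.1 0) (by
      rintro ⟨i, u, hu⟩ ⟨j, v, hv⟩
      have hB : 0 ≤ B := (abs_nonneg u).trans hu
      by_cases hij : i = j
      · subst hij
        simpa using abs_sub_le_of_lipschitz (hσ i) u v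
      · have h1 : |σ i u - σ i 0| ≤ B := by
          simpa using (abs_sub_le_of_lipschitz (hσ i) u 0).trans (by simpa using hu)
        have h2 : |σ j v - σ j 0| ≤ B := by
          simpa using (abs_sub_le_of_lipschitz (hσ j) v 0).trans (by simpa using hv)
        have h3 : 4 * B ≤ |s i - s j| := by
          have hne : ((Fintype.equivFin ι i : ℕ) : ℤ) - (Fintype.equivFin ι j : ℕ) ≠ 0 := by
            rw [sub_ne_zero]
            intro h
            exact hij ((Fintype.equivFin ι).injective (Fin.ext (by exact_mod_cast h)))
          have h4 : (1 : ℝ) ≤ |((Fintype.equivFin ι i : ℕ) : ℝ) - (Fintype.equivFin ι j : ℕ)| := by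
            exact_mod_cast Int.one_le_abs hne
          rw [show s i - s j = 4 * B * (((Fintype.equivFin ι i : ℕ) : ℝ) -
            (Fintype.equivFin ι j : ℕ)) by simp only [s]; ring, abs_mul,
            abs_of_nonneg (by positivity : 0 ≤ 4 * B)]
          nlinarith
        simp only
        calc |σ i u - σ i 0 - (σ j v - σ j 0)| ≤ |σ i u - σ i 0| + |σ j v - σ j 0| := abs_sub _ _
          _ ≤ 4 * B - |u| - |v| := by linarith
          _ ≤ |s i - s j| - |u| - |v| := by linarith
          _ ≤ |u + s i - (v + s j)| := by
            have e1 : s i - s j = (u + s i - (v + s j)) + (v - u) := by ring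
            have e2 := abs_add_le (u + s i - (v + s j)) (v - u)
            have e3 := abs_sub v u
            rw [← e1] at e2
            linarith)
  exact ⟨τ, s, hτ, fun i u hu => h (i, ⟨u, hu⟩)⟩

lemma abs_le_one_of_mem_cube {m : ℕ} {x : Fin m → ℝ} (hx : x ∈ cube m) (j : Fin m) : |x j| ≤ 1 :=
  abs_le.2 ⟨by linarith [show 0 ≤ x j from hx.1 j], hx.2 j⟩

/-- An encoder computing given shallow networks together with a multiple of the indicators of the
complements of given sets of positions. -/
lemma exists_encoder {d T D : ℕ} (p : Fin D → ℕ) (σ : Fin D → ℝ → ℝ)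
    (hσ : ∀ i, LipschitzWith 1 (σ i)) (A : ∀ i, Fin (p i) → Fin d → ℝ) (b a : ∀ i, Fin (p i) → ℝ)
    (c : Fin D → ℝ) (S : Fin D → Finset (Fin T)) (μ : ℝ) :
    ∃ (τ : ℝ → ℝ) (P : FFN (D * 2) 2 (d + T)), LipschitzWith 1 τ ∧
      P.paramCount ≤ ((∑ i, p i) + D) * (d + T + 1 + D * 2) + D * 2 ∧
      ∀ x ∈ cube d, ∀ (t : Fin T) (i : Fin D),
        encode τ P x t (finProdFinEquiv (i, 0)) = shallow (σ i) (A i) (b i) (a i) (c i) x ∧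
        encode τ P x t (finProdFinEquiv (i, 1)) = if t ∈ S i then 0 else μ := by
  classical
  obtain ⟨B, hB⟩ : ∃ B : ℝ, ∀ q : Option ((i : Fin D) × Fin (p i)),
      (q.elim 1 fun q => ∑ j, |A q.1 q.2 j| + |b q.1 q.2|) ≤ B := by
    obtain ⟨B, hB⟩ := Set.Finite.bddAbove (Set.finite_range
      fun q : Option ((i : Fin D) × Fin (p i)) => q.elim 1 fun q => ∑ j, |A q.1 q.2 j| + |b q.1 q.2|)
    exact ⟨B, fun q => hB ⟨q, rfl⟩⟩
  -- The extra index `none` carries the identity, used by the units that detect positions outside `S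
  -- i`; `B` bounds every preactivation on the cube.
  obtain ⟨τ, s, hτ, hs⟩ := exists_common_activation
    (fun o : Option (Fin D) => o.elim id σ) (fun o => by
      cases o with
      | none => exact LipschitzWith.id
      | some i => exact hσ i) B
  have hsome : ∀ i r, ∀ x ∈ cube d,
      τ (∑ j, A i r j * x j + (b i r + s (some i))) =
        σ i (∑ j, A i r j * x j + b i r) - σ i 0 := by
    intro i r x hx
    rw [← add_assoc]
    refine hs (some i) _ (le_trans ?_ (hB (some ⟨i, r⟩)))
    refine (abs_add_le _ _).trans (add_le_add_left ?_ _)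
    refine (Finset.abs_sum_le_sum_abs _ _).trans (Finset.sum_le_sum fun j _ => ?_)
    rw [abs_mul]
    exact mul_le_of_le_one_right (abs_nonneg _) (abs_le_one_of_mem_cube hx j)
  have hnone : ∀ u : ℝ, |u| ≤ 1 → τ (u + s none) = u := fun u hu => by
    simpa using hs none u (hu.trans (hB none))
  let ι := ((i : Fin D) × Fin (p i)) ⊕ Fin D
  -- The common activation reproduces `σ i` only up to the constant `σ i 0`; the output bias
  -- restores these constants.
  have hout : Realizes τ Set.univ 1 (D * 2 * Fintype.card ι + D * 2)
      (fun (h : ι → ℝ) (q : Fin (D * 2)) => ∑ k, Sum.elim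
          (fun k : (i : Fin D) × Fin (p i) => if finProdFinEquiv.symm q = (k.1, 0) then a k.1 k.2 else 0)
          (fun i => if finProdFinEquiv.symm q = (i, 1) then μ else 0) k * h k +
        (if (finProdFinEquiv.symm q).2 = 0 then c (finProdFinEquiv.symm q).1 +
          ∑ r, a (finProdFinEquiv.symm q).1 r * σ (finProdFinEquiv.symm q).1 0 else 0)) :=
    Realizes.output (fun q => Sum.elim
          (fun k : (i : Fin D) × Fin (p i) => if finProdFinEquiv.symm q = (k.1, 0) then a k.1 k.2 else 0)
          (fun i => if finProdFinEquiv.symm q = (i, 1) then μ else 0)) _ (fun _ _ => trivial)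
        (fun _ => trivial)
      ((entryCount_le _ _).trans_eq (by rw [Fintype.card_fin]))
  obtain ⟨P, -, hP, hev⟩ := Realizes.layer (ι := Fin d ⊕ Fin T) (κ := ι)
    (Sum.elim (fun k => Sum.elim (A k.1 k.2) 0) (fun i => Sum.elim 0 fun t => if t ∈ S i then 0 else 1))
    (Sum.elim (fun k => b k.1 k.2 + s (some k.1)) (fun i => s none))
    (fun _ _ => Set.mem_univ _) (fun _ => Set.mem_univ _) (entryCount_le _ _) hout (d + T) finSumFinEquiv
  refine ⟨τ, P, hτ, hP.trans_eq ?_, fun x hx t i => ?_⟩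
  · simp only [ι, Fintype.card_sum, Fintype.card_sigma, Fintype.card_fin]
    ring
  · have hin : ∀ e : Fin d ⊕ Fin T, (Fin.append x (Pi.single t (1 : ℝ)) : Fin (d + T) → ℝ)
        (finSumFinEquiv e) = Sum.elim x (Pi.single t 1) e := by
      rintro (j | t') <;> simp
    have hm : τ ((if t ∈ S i then 0 else 1) + s none) = if t ∈ S i then 0 else 1 := by
      refine hnone _ ?_
      split_ifs <;> simp
    constructor
    · simp only [encode, hev, hin, Fintype.sum_sum_type, Sum.elim_inl, Sum.elim_inr,
        Equiv.symm_apply_apply, Prod.mk.injEq, Pi.zero_apply, zero_mul, Finset.sum_const_zero,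
        add_zero, zero_add, Fintype.sum_sigma, hsome _ _ x hx, zero_ne_one, and_false, if_false,
        and_true, if_true, shallow, ite_mul]
      rw [Finset.sum_eq_single i (fun j _ hj => by simp [hj.symm]) (by simp)]
      simp only [if_true, mul_sub, Finset.sum_sub_distrib]
      rw [Equiv.symm_apply_apply]
      ring
    · simp only [encode, hev, hin, Fintype.sum_sum_type, Sum.elim_inl, Sum.elim_inr,
        Equiv.symm_apply_apply, Prod.mk.injEq, Pi.zero_apply, zero_mul, Finset.sum_const_zero,
        add_zero, zero_add, one_ne_zero, and_false, if_false,
        and_true, ite_mul, Pi.single_apply, mul_ite, mul_one, mul_zero,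
        Finset.sum_ite_eq, Finset.sum_ite_eq', Finset.mem_univ, if_true, hm]

/-! ### Attention heads as soft minima. -/

/-- The attention layer in which head `i` reads the two coordinates of block `i`, uses minus their
sum as score, and returns the first one. -/
noncomputable def minAttention (D : ℕ) (β : ℝ) : Attention D 2 where
  WQ i r q := if r = 0 ∧ q = finProdFinEquiv (i, 1) then 1 else 0
  WK i r q := if r = 0 ∧ (finProdFinEquiv.symm q).1 = i then -1 else 0
  WV i r q := if r = 0 ∧ q = finProdFinEquiv (i, 0) then 1 else 0
  WO := 1
  c₀ q := if (finProdFinEquiv.symm q).2 = 1 then 1 else 0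
  β := β

lemma minAttention_admissible (D : ℕ) {β : ℝ} (hβ : 0 < β) : (minAttention D β).Admissible := by
  refine ⟨hβ, fun i r j => ?_, fun i r j => ?_, fun i r j => ?_, fun r j => ?_⟩
  · simp only [minAttention]; split_ifs <;> simp
  · simp only [minAttention]; split_ifs <;> simp
  · simp only [minAttention]; split_ifs <;> simp
  · simp only [minAttention, Matrix.one_apply]; split_ifs <;> simp

/-- The token `c₀` is 1 on the second coordinate of each block, so every query is the first unit
vector, and 0 on the first coordinate, so the residual term leaves the head output unchanged. -/
lemma minAttention_out (D : ℕ) (β : ℝ) {T : ℕ} (e : Fin T → Fin (D * 2) → ℝ) (i : Fin D) :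
    (minAttention D β).out e (finProdFinEquiv (i, 0)) =
      ∑ t, softmax β (fun t' => -(e t' (finProdFinEquiv (i, 0)) + e t' (finProdFinEquiv (i, 1)))) t *
        e t (finProdFinEquiv (i, 0)) := by
  have hQ : (minAttention D β).WQ i *ᵥ (minAttention D β).c₀ = Pi.single 0 1 := by
    ext r
    simp only [minAttention, Matrix.mulVec, dotProduct, ite_and, Pi.single_apply, ite_mul, one_mul,
      zero_mul]
    split_ifs
    · rw [Finset.sum_ite_eq' Finset.univ (finProdFinEquiv (i, (1 : Fin 2))), Equiv.symm_apply_apply]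
      simp
    · simp
  have hK : ∀ t, ((minAttention D β).WK i *ᵥ e t) 0 =
      -(e t (finProdFinEquiv (i, 0)) + e t (finProdFinEquiv (i, 1))) := by
    intro t
    simp only [minAttention, Matrix.mulVec, dotProduct, true_and]
    rw [← finProdFinEquiv.sum_comp, Fintype.sum_prod_type]
    simp only [Equiv.symm_apply_apply, ite_mul, zero_mul, Finset.sum_ite_irrel,
      Finset.sum_ite_eq', Finset.mem_univ, if_true, Fin.sum_univ_two, Finset.sum_const_zero]
    ring
  have hV : ∀ t, ((minAttention D β).WV i *ᵥ e t) 0 = e t (finProdFinEquiv (i, 0)) := by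
    intro t
    simp [minAttention, Matrix.mulVec, dotProduct]
  have hO : (minAttention D β).WO *ᵥ (minAttention D β).concatHeads e =
      (minAttention D β).concatHeads e := by
    simp [minAttention]
  have hc : (minAttention D β).c₀ (finProdFinEquiv (i, 0)) = 0 := by
    simp only [minAttention, Equiv.symm_apply_apply, zero_ne_one, if_false]
  rw [Attention.out, Pi.add_apply, hO, hc, zero_add]
  simp only [Attention.concatHeads, Equiv.symm_apply_apply, Attention.head, hQ,
    single_dotProduct, hK, one_mul, Finset.sum_apply, Pi.smul_apply, hV, smul_eq_mul]
  rfl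

lemma softmax_nonneg {β : ℝ} {T : ℕ} (ρ : Fin T → ℝ) (t : Fin T) : 0 ≤ softmax β ρ t := by
  unfold softmax; positivity

lemma sum_softmax {β : ℝ} {T : ℕ} (hT : 1 ≤ T) (ρ : Fin T → ℝ) : ∑ t, softmax β ρ t = 1 := by
  have : Nonempty (Fin T) := ⟨⟨0, hT⟩⟩
  simp only [softmax]
  rw [← Finset.sum_div, div_self]
  exact (Finset.sum_pos (fun t _ => Real.exp_pos _) Finset.univ_nonempty).ne'

/-- Lets the scaling factor absorb a contraction of the embedding. -/
lemma softmax_mul (β lam : ℝ) {T : ℕ} (ρ : Fin T → ℝ) (t : Fin T) :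
    softmax β (fun t => lam * ρ t) t = softmax (β * lam) ρ t := by
  simp only [softmax, mul_assoc]

/-- A weighted mean of numbers in `[0, 1]` with softmax weights lies in `[0, 1]`. -/
lemma sum_softmax_mul_mem {β : ℝ} {T : ℕ} (hT : 1 ≤ T) (ρ v : Fin T → ℝ)
    (hv : ∀ t, v t ∈ Set.Icc (0 : ℝ) 1) : ∑ t, softmax β ρ t * v t ∈ Set.Icc (0 : ℝ) 1 := by
  refine ⟨Finset.sum_nonneg fun t _ => mul_nonneg (softmax_nonneg _ _) (hv t).1, ?_⟩
  rw [← sum_softmax (β := β) hT ρ]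
  exact Finset.sum_le_sum fun t _ => mul_le_of_le_one_right (softmax_nonneg _ _) (hv t).2

/-- The softmin of `v` over the positions in `S`, computed with a penalty outside of `S`. -/
lemma abs_softmin_sub_le {β : ℝ} (hβ : 0 < β) {T : ℕ} (v : Fin T → ℝ)
    (hv : ∀ t, v t ∈ Set.Icc (0 : ℝ) 1) (S : Finset (Fin T)) {m : ℝ} (hm : ∀ t ∈ S, m ≤ v t)
    (hm' : ∃ t ∈ S, v t = m) :
    |∑ t, softmax β (fun t => -(v t + if t ∈ S then 0 else 2)) t * v t - m| ≤ T / β := by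
  obtain ⟨t₀, ht₀, rfl⟩ := hm'
  have hT : 1 ≤ T := by have := t₀.2; omega
  set g : Fin T → ℝ := fun t => v t + if t ∈ S then 0 else 2 with hg
  set w : Fin T → ℝ := softmax β (fun t => -g t) with hw
  have hw0 : ∀ t, 0 ≤ w t := fun t => softmax_nonneg _ _
  -- The penalty 2 suffices: outside `S` the right side is at least 1, and values in `[0, 1]` differ
  -- by at most 1. Each error term is thus a weight times its own score gap.
  have hg0 : ∀ t, |v t - v t₀| ≤ g t - v t₀ := by
    intro t
    by_cases ht : t ∈ S
    · have := hm t ht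
      simp only [hg, ht, if_true, add_zero]
      rw [abs_of_nonneg (by linarith)]
    · simp only [hg, ht, if_false]
      rw [abs_le]
      constructor <;> linarith [(hv t).1, (hv t).2, (hv t₀).1, (hv t₀).2]
  have hgt : g t₀ = v t₀ := by simp [hg, ht₀]
  have hwle : ∀ t, w t * (g t - v t₀) ≤ 1 / β := by
    intro t
    have h0 : 0 ≤ g t - v t₀ := (abs_nonneg _).trans (hg0 t)
    have h1 : w t ≤ Real.exp (-(β * (g t - v t₀))) := by
      have : Real.exp (β * -g t₀) ≤ ∑ t', Real.exp (β * -g t') :=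
        Finset.single_le_sum (f := fun t' => Real.exp (β * -g t'))
          (fun t _ => (Real.exp_pos _).le) (Finset.mem_univ t₀)
      simp only [hw, softmax]
      rw [div_le_iff₀ (lt_of_lt_of_le (Real.exp_pos _) this)]
      calc Real.exp (β * -g t) = Real.exp (-(β * (g t - v t₀))) * Real.exp (β * -g t₀) := by
            rw [← Real.exp_add, hgt]; ring_nf
        _ ≤ _ := by gcongr
    have h2 : β * (g t - v t₀) * Real.exp (-(β * (g t - v t₀))) ≤ 1 := by
      rw [Real.exp_neg, ← div_eq_mul_inv, div_le_one (Real.exp_pos _)]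
      linarith [Real.add_one_le_exp (β * (g t - v t₀))]
    rw [le_div_iff₀ hβ]
    calc w t * (g t - v t₀) * β ≤ Real.exp (-(β * (g t - v t₀))) * (g t - v t₀) * β := by gcongr
      _ ≤ 1 := by linarith
  have hsum : ∑ t, w t * v t - v t₀ = ∑ t, w t * (v t - v t₀) := by
    simp only [mul_sub, Finset.sum_sub_distrib, ← Finset.sum_mul]
    rw [hw, sum_softmax hT, one_mul]
  rw [hsum]
  calc |∑ t, w t * (v t - v t₀)| ≤ ∑ t, |w t * (v t - v t₀)| := Finset.abs_sum_le_sum_abs _ _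
    _ ≤ ∑ t : Fin T, 1 / β := by
        refine Finset.sum_le_sum fun t _ => ?_
        rw [abs_mul, abs_of_nonneg (hw0 t)]
        exact (mul_le_mul_of_nonneg_left (hg0 t) (hw0 t)).trans (hwle t)
    _ = T / β := by simp [div_eq_mul_inv]

/-- A feed-forward block that undoes a contraction of its input by an integer factor. -/
lemma exists_rescaled_shallow {D p K : ℕ} (hK : 1 ≤ K) {σ : ℝ → ℝ} (hσ : LipschitzWith 1 σ)
    (A : Fin p → Fin D → ℝ) (b a : Fin p → ℝ) (c : ℝ) (hA : ∀ r j, A r j ∈ unitWeights)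
    (hb : ∀ r, b r ∈ unitWeights) (ha : ∀ r, a r ∈ unitWeights) (hc : c ∈ unitWeights) :
    ∃ (τ : ℝ → ℝ) (G : FFN 1 2 (D * 2)), LipschitzWith 1 τ ∧ G.WeightsIn unitWeights ∧
      G.paramCount ≤ p * (K * (D * 2 + 2)) + 1 ∧
      ∀ y, G.eval τ y 0 = shallow σ A b a c fun i => K * y (finProdFinEquiv (i, 0)) := by
  have hK0 : (0 : ℝ) < K := by exact_mod_cast hK
  have hK1 : (1 : ℝ) ≤ K := by exact_mod_cast hK
  have h0 : (0 : ℝ) ∈ unitWeights := by simp [unitWeights]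
  -- The weights may not grow, but the activation may be replaced by `σ (K * u) / K`, which is again
  -- 1-Lipschitz. It undoes the contraction inside `σ`, and `K` copies of each hidden unit cancel
  -- the outer factor `1 / K`.
  have hout : Realizes (fun u => σ (K * u) / K) unitWeights 1 (1 * Fintype.card (Fin p × Fin K) + 1)
      (fun (h : Fin p × Fin K → ℝ) (_ : Fin 1) => ∑ k, a k.1 * h k + c) :=
    Realizes.output (fun _ (k : Fin p × Fin K) => a k.1) (fun _ => c) (fun _ k => ha _) (fun _ => hc)
      ((entryCount_le _ _).trans_eq (by rw [Fintype.card_fin]))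
  obtain ⟨G, hW, hG, hev⟩ := Realizes.layer (ι := Fin D × Fin 2) (κ := Fin p × Fin K)
    (fun k q => if q.2 = 0 then A k.1 q.1 else 0) (fun k => b k.1 / K)
    (fun k q => by split_ifs; exacts [hA _ _, h0])
    (fun k => by
      have := hb k.1
      simp only [unitWeights, Set.mem_Icc] at this ⊢
      rw [le_div_iff₀ hK0, div_le_iff₀ hK0]
      constructor <;> linarith)
    (entryCount_le _ _) hout (D * 2) finProdFinEquiv
  refine ⟨fun u => σ (K * u) / K, G, ?_, hW, hG.trans_eq ?_, fun y => ?_⟩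
  · refine LipschitzWith.of_dist_le_mul fun x y => ?_
    simp only [Real.dist_eq, NNReal.coe_one, one_mul, ← sub_div, abs_div, abs_of_pos hK0]
    rw [div_le_iff₀ hK0]
    refine (abs_sub_le_of_lipschitz hσ _ _).trans_eq ?_
    rw [← mul_sub, abs_mul, abs_of_pos hK0, mul_comm]
  · simp only [Fintype.card_prod, Fintype.card_fin]
    ring
  · rw [hev]
    simp only [Fintype.sum_prod_type, shallow, Finset.sum_const, Finset.card_univ, Fintype.card_fin,
      nsmul_eq_mul, Fin.sum_univ_two, if_true, one_ne_zero, if_false, zero_mul, add_zero]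
    congr 1
    refine Finset.sum_congr rfl fun r _ => ?_
    rw [show (K : ℝ) * (∑ j, A r j * y (finProdFinEquiv (j, 0)) + b r / K) =
      ∑ j, A r j * (K * y (finProdFinEquiv (j, 0))) + b r by
        rw [mul_add, mul_div_cancel₀ _ hK0.ne', Finset.mul_sum]
        congr 1
        exact Finset.sum_congr rfl fun j _ => by ring]
    field_simp


lemma iInf_mem_eq {T : ℕ} {S : Finset (Fin T)} (v : Fin T → ℝ) (hS : S.Nonempty) :
    (∀ t ∈ S, ⨅ t : {t // t ∈ S}, v t ≤ v t) ∧ ∃ t ∈ S, v t = ⨅ t : {t // t ∈ S}, v t := by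
  have : Nonempty {t // t ∈ S} := hS.to_subtype
  obtain ⟨t, ht⟩ := exists_eq_ciInf_of_finite (f := fun t : {t // t ∈ S} => v t)
  exact ⟨fun t ht => ciInf_le (Set.finite_range fun t : {t // t ∈ S} => v t).bddBelow ⟨t, ht⟩,
    t, t.2, ht⟩

lemma abs_iInf_sub_iInf_le {T : ℕ} {S : Finset (Fin T)} (v w : Fin T → ℝ) (hS : S.Nonempty) {c : ℝ}
    (h : ∀ t, |v t - w t| ≤ c) :
    |(⨅ t : {t // t ∈ S}, v t) - ⨅ t : {t // t ∈ S}, w t| ≤ c := by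
  obtain ⟨h1, t, ht, h2⟩ := iInf_mem_eq v hS
  obtain ⟨h3, u, hu, h4⟩ := iInf_mem_eq w hS
  have := abs_le.1 (h t)
  have := abs_le.1 (h u)
  rw [abs_le]
  constructor <;> linarith [h1 u hu, h3 t ht]

lemma iInf_mem_Icc {T : ℕ} {S : Finset (Fin T)} (v : Fin T → ℝ) (hS : S.Nonempty)
    (hv : ∀ t, v t ∈ Set.Icc (0 : ℝ) 1) : ⨅ t : {t // t ∈ S}, v t ∈ Set.Icc (0 : ℝ) 1 := by
  obtain ⟨-, t, -, h⟩ := iInf_mem_eq v hS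
  exact h ▸ hv t

lemma shallow_affine (σ : ℝ → ℝ) {p m : ℕ} (A : Fin p → Fin m → ℝ) (b a : Fin p → ℝ) (c k e : ℝ)
    (x : Fin m → ℝ) :
    shallow σ A b (fun r => k * a r) (k * c + e) x = k * shallow σ A b a c x + e := by
  simp only [shallow, mul_add, Finset.mul_sum]
  rw [add_assoc]
  congr 1
  exact Finset.sum_congr rfl fun r _ => by ring

/-! ### Assembly of the transformer with `D` heads. -/

/-- The transformer with one head per component of the target, built from shallow approximations of
the components. -/
lemma exists_multihead_approximation {d T D p₀ : ℕ} (hT : 1 ≤ T) (hD : 1 ≤ D)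
    {F₀ : (Fin D → ℝ) → ℝ} {f : Fin D → (Fin d → ℝ) → ℝ} {S : Fin D → Finset (Fin T)}
    (hf : ∀ i, Set.MapsTo (f i) (cube d) (Set.Icc 0 1)) (hS : ∀ i, (S i).Nonempty) {Λ : ℝ≥0}
    (hΛ : LipschitzOnWith Λ F₀ (cube D)) {δ κ : ℝ} (hδ : 0 < δ) (hκ : 0 < κ)
    {σ₀ : ℝ → ℝ} (hσ₀ : LipschitzWith 1 σ₀) {A₀ : Fin p₀ → Fin D → ℝ} {b₀ a₀ : Fin p₀ → ℝ} {c₀ : ℝ}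
    (hA₀ : ∀ r j, A₀ r j ∈ unitWeights) (hb₀ : ∀ r, b₀ r ∈ unitWeights)
    (ha₀ : ∀ r, a₀ r ∈ unitWeights) (hc₀ : c₀ ∈ unitWeights)
    (h₀ : ∀ z ∈ cube D, |F₀ z - shallow σ₀ A₀ b₀ a₀ c₀ z| ≤ δ)
    {p : Fin D → ℕ} {σ : Fin D → ℝ → ℝ} (hσ : ∀ i, LipschitzWith 1 (σ i))
    {A : ∀ i, Fin (p i) → Fin d → ℝ} {b a : ∀ i, Fin (p i) → ℝ} {c : Fin D → ℝ}
    (h : ∀ i, ∀ x ∈ cube d, |f i x - shallow (σ i) (A i) (b i) (a i) (c i) x| ≤ δ) :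
    ∃ H ∈ hypothesisClass lipschitzActivations 2 2 D 2 d T
      (((∑ i, p i) + D) * (d + T + 1 + D * 2) + D * 2 + (p₀ * (3 * D * (D * 2 + 2)) + 1)),
      ∀ X ∈ inputSpace d T, |H X - retrievalTarget F₀ f S X| ≤ δ + Λ * (2 * δ + κ) := by
  have hK : 1 ≤ 3 * D := by omega
  have hD1 : (1 : ℝ) ≤ D := by exact_mod_cast hD
  have hK0 : (0 : ℝ) < 3 * D := by linarith
  have hT0 : (0 : ℝ) < T := by exact_mod_cast hT
  have hδ' : 0 < 1 + 2 * δ := by linarith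
  -- Each block has squared norm at most `5 * lam ^ 2`, so this contraction keeps the squared norm
  -- of the encoder below `5 / (9 * D)`.
  set lam : ℝ := 1 / (3 * D) with hlam
  have hlam0 : 0 < lam := by positivity
  -- The approximation has values in `[-δ, 1 + δ]`; an affine map brings them back to `[0, 1]` at
  -- the cost of another `δ`. The averages then stay in the cube where `F₀` is approximated.
  let g : Fin D → (Fin d → ℝ) → ℝ := fun i x =>
    (shallow (σ i) (A i) (b i) (a i) (c i) x + δ) / (1 + 2 * δ)
  have hg : ∀ i, ∀ x ∈ cube d, g i x ∈ Set.Icc (0 : ℝ) 1 := by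
    intro i x hx
    have h1 := abs_le.1 (h i x hx)
    have h2 := hf i hx
    simp only [g, Set.mem_Icc]
    rw [le_div_iff₀ hδ', div_le_iff₀ hδ']
    constructor <;> linarith [h2.1, h2.2]
  have hgf : ∀ i, ∀ x ∈ cube d, |g i x - f i x| ≤ 2 * δ := by
    intro i x hx
    have h1 := abs_le.1 (h i x hx)
    have h2 := hf i hx
    have h3 : g i x - f i x =
        (shallow (σ i) (A i) (b i) (a i) (c i) x - f i x + δ * (1 - 2 * f i x)) / (1 + 2 * δ) := by
      simp only [g]
      field_simp
      ring
    rw [h3, abs_div, abs_of_pos hδ', div_le_iff₀ hδ', abs_le]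
    constructor <;> nlinarith [h2.1, h2.2]
  obtain ⟨τ, P, hτ, hP, hPev⟩ := exists_encoder p σ hσ A b (fun i r => lam / (1 + 2 * δ) * a i r)
    (fun i => lam / (1 + 2 * δ) * c i + lam / (1 + 2 * δ) * δ) S (lam * 2)
  obtain ⟨τ', G, hτ', hGW, hG, hGev⟩ := exists_rescaled_shallow hK hσ₀ A₀ b₀ a₀ c₀ hA₀ hb₀ ha₀ hc₀
  have hv : ∀ x ∈ cube d, ∀ (t : Fin T) i,
      encode τ P x t (finProdFinEquiv (i, 0)) = lam * g i x := by
    intro x hx t i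
    rw [(hPev x hx t i).1, shallow_affine]
    simp only [g]
    field_simp
  -- The factor `3 * D` compensates the contraction of the scores; the effective value `T / κ` makes
  -- the softmin error `κ`.
  have hβ : 0 < (3 * D) * (T / κ) := by positivity
  refine ⟨_, ⟨τ, hτ, τ', hτ', P, minAttention D ((3 * D) * (T / κ)), G, fun x hx t => ?_,
    minAttention_admissible D hβ, hGW, add_le_add hP hG, rfl⟩, fun X hX => ?_⟩
  · rw [Real.sqrt_le_left zero_le_one, one_pow, ← finProdFinEquiv.sum_comp, Fintype.sum_prod_type]
    have hb : ∀ i : Fin D, ∑ r : Fin 2, encode τ P x t (finProdFinEquiv (i, r)) ^ 2 ≤ 5 * lam ^ 2 := by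
      intro i
      rw [Fin.sum_univ_two, hv x hx t i, (hPev x hx t i).2]
      have h1 : (lam * g i x) ^ 2 ≤ lam ^ 2 := by
        rw [mul_pow]
        have h2 := hg i x hx
        exact mul_le_of_le_one_right (by positivity) (pow_le_one₀ h2.1 h2.2)
      have h2 : (if t ∈ S i then 0 else lam * 2) ^ 2 ≤ 4 * lam ^ 2 := by
        split_ifs
        · simp; positivity
        · nlinarith
      linarith
    refine (Finset.sum_le_sum fun i _ => hb i).trans ?_
    simp only [Finset.sum_const, Finset.card_univ, Fintype.card_fin, nsmul_eq_mul, hlam]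
    rw [div_pow, one_pow, ← mul_div_assoc, ← mul_div_assoc, div_le_one (by positivity)]
    nlinarith
  · simp only [hGev]
    set e : Fin T → Fin (D * 2) → ℝ := fun t => encode τ P (X t) t with he
    set z : Fin D → ℝ := fun i => ∑ t, softmax (T / κ)
      (fun t => -(g i (X t) + if t ∈ S i then 0 else 2)) t * g i (X t) with hz
    have hout : (fun i => ((3 * D : ℕ) : ℝ) * (minAttention D ((3 * D) * (T / κ))).out e
        (finProdFinEquiv (i, 0))) = z := by
      ext i
      rw [minAttention_out, hz, Finset.mul_sum]
      refine Finset.sum_congr rfl fun t _ => ?_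
      have hsc : (fun t' => -(e t' (finProdFinEquiv (i, 0)) + e t' (finProdFinEquiv (i, 1)))) =
          fun t' => lam * -(g i (X t') + if t' ∈ S i then 0 else 2) := by
        ext t'
        simp only [he]
        rw [hv _ (hX t') t' i, (hPev _ (hX t') t' i).2]
        split_ifs <;> ring
      rw [hsc, softmax_mul, show (3 * D : ℝ) * (T / κ) * lam = T / κ by
        rw [hlam]; field_simp]
      simp only [he]
      rw [hv _ (hX t) t i, hlam]
      push_cast
      field_simp
    rw [hout]
    have hzc : z ∈ cube D := by
      rw [cube, Set.mem_Icc, Pi.le_def, Pi.le_def]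
      have := fun i => sum_softmax_mul_mem (β := T / κ) hT
        (fun t => -(g i (X t) + if t ∈ S i then 0 else 2)) _ fun t => hg i (X t) (hX t)
      exact ⟨fun i => (this i).1, fun i => (this i).2⟩
    set y : Fin D → ℝ := fun i => ⨅ t : {t // t ∈ S i}, f i (X t) with hy
    have hyc : y ∈ cube D := by
      rw [cube, Set.mem_Icc, Pi.le_def, Pi.le_def]
      have := fun i => iInf_mem_Icc _ (hS i) fun t => hf i (hX t)
      exact ⟨fun i => (this i).1, fun i => (this i).2⟩
    have hdist : dist z y ≤ 2 * δ + κ := by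
      refine (dist_pi_le_iff (by positivity)).2 fun i => ?_
      have h1 := iInf_mem_eq (fun t => g i (X t)) (hS i)
      have h2 := abs_softmin_sub_le (β := T / κ) (by positivity) (fun t => g i (X t))
        (fun t => hg i (X t) (hX t)) (S i) h1.1 h1.2
      have h3 := abs_iInf_sub_iInf_le (fun t => g i (X t)) (fun t => f i (X t)) (hS i)
        fun t => hgf i (X t) (hX t)
      rw [div_div_cancel₀ hT0.ne'] at h2
      rw [Real.dist_eq]
      refine (abs_sub_le _ _ _).trans ((add_le_add h2 h3).trans_eq (add_comm _ _))
    have h1 := h₀ z hzc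
    have h2 := hΛ.dist_le_mul z hzc y hyc
    rw [Real.dist_eq] at h2
    have h3 : (Λ : ℝ) * dist z y ≤ Λ * (2 * δ + κ) := by gcongr
    rw [abs_sub_comm] at h1
    calc |shallow σ₀ A₀ b₀ a₀ c₀ z - F₀ y| ≤ _ := abs_sub_le _ (F₀ z) _
      _ ≤ δ + Λ * (2 * δ + κ) := by linarith

lemma IsRetrievalTask.nonempty {d T D : ℕ} (hT : 1 ≤ T) {F₀ : (Fin D → ℝ) → ℝ}
    {f : Fin D → (Fin d → ℝ) → ℝ} {S : Fin D → Finset (Fin T)} {xmin : Fin D → Fin d → ℝ}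
    (h : IsRetrievalTask F₀ f S xmin) (i : Fin D) : (S i).Nonempty := by
  rw [← Finset.card_pos]
  have h1 := h.quarter_le_card i
  have h2 : (0 : ℝ) < T := by exact_mod_cast hT
  have : (0 : ℝ) < (S i).card := by linarith
  exact_mod_cast this

lemma hypothesisClass_mono {𝒜 : Set (ℝ → ℝ)} {ℓ L h n d T M M' : ℕ} (hM : M ≤ M') :
    hypothesisClass 𝒜 ℓ L h n d T M ⊆ hypothesisClass 𝒜 ℓ L h n d T M' := by
  rintro H ⟨σ, hσ, τ, hτ, P, a, G, h1, h2, h3, h4, h5⟩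
  exact ⟨σ, hσ, τ, hτ, P, a, G, h1, h2, h3, h4.trans hM, h5⟩

/-- Targets with bounded-weight approximations are approximated by zero once `ε` is large. -/
lemma epsApproximates_of_lt {𝒜 𝒜' : Set (ℝ → ℝ)} (h𝒜 : 𝒜.Nonempty) {W : Set ℝ}
    {d T D : ℕ} (hT : 1 ≤ T) {C₁ γ₁ C₂ γ₂ : ℝ} {Λ : ℝ≥0} (hC₁ : 0 < C₁) (hγ₁ : 0 < γ₁) {ε : ℝ}
    (hε : 1 + (C₁ + 1) ^ (1 / γ₁) < ε) (ℓ L h n M : ℕ) :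
    EpsApproximates (hypothesisClass 𝒜 (ℓ + 1) (L + 1) h n d T M) ε
      (approxTargetClass 𝒜' W d T D C₁ γ₁ C₂ γ₂ Λ) := by
  rintro F ⟨F₀, f, S, xmin, htask, -, happ, -, rfl⟩
  refine ⟨_, zero_mem_hypothesisClass h𝒜 ℓ L h n d T M, _, hε, fun X hX => ?_⟩
  rw [zero_sub, abs_neg]
  refine happ.abs_le hC₁ hγ₁ _ ?_
  rw [cube, Set.mem_Icc, Pi.le_def, Pi.le_def]
  have := fun i => iInf_mem_Icc _ (htask.nonempty hT i) fun t => htask.mapsTo_comp i (hX t)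
  exact ⟨fun i => (this i).1, fun i => (this i).2⟩

/-- For `ε` above a bound on the targets the zero transformer suffices. Below it, taking all
accuracies equal to `ε / k` gives the error `(1 + 3 * Λ) * ε / k < ε`. -/
theorem multihead_upper_bound {d T D : ℕ} (hT : 1 ≤ T) (hD : 1 ≤ D) (C₁ γ₁ C₂ γ₂ : ℝ) (Λ : ℝ≥0)
    (hC₁ : 0 < C₁) (hγ₁ : 0 < γ₁) (hC₂ : 0 < C₂) :
    ∃ C : ℝ, 0 < C ∧ ∀ ε : ℝ, 0 < ε → ∀ M : ℕ, C / ε ^ max γ₁ γ₂ < M →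
      EpsApproximates (hypothesisClass lipschitzActivations 2 2 D 2 d T M) ε
        (approxTargetClass lipschitzActivations Set.univ d T D C₁ γ₁ C₂ γ₂ Λ) := by
  set R : ℝ := 1 + (C₁ + 1) ^ (1 / γ₁) with hR
  have hR0 : 0 < R := by positivity
  set k : ℝ := 2 + 4 * Λ with hk
  have hk0 : 0 < k := by positivity
  obtain ⟨K₁, hK₁, h₁⟩ := exists_div_rpow_le hC₁.le hk0 hR0 (le_max_left γ₁ γ₂)
  obtain ⟨K₂, hK₂, h₂⟩ := exists_div_rpow_le hC₂.le hk0 hR0 (le_max_right γ₁ γ₂)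
  -- On the bounded range of `ε` this gives `1 ≤ K₀ / ε ^ max γ₁ γ₂`, so constant terms of the
  -- parameter count are absorbed into the rate.
  obtain ⟨K₀, hK₀, h₀⟩ := exists_div_rpow_le (zero_le_one' ℝ) hk0 hR0
    (hγ₁.le.trans (le_max_left γ₁ γ₂))
  refine ⟨(D * K₂ + D * K₀) * (d + T + 1 + D * 2) + (D * 2) * K₀ +
    (K₁ * (3 * D * (D * 2 + 2)) + K₀) + 1, by positivity, fun ε hε M hM => ?_⟩
  rcases lt_or_ge R ε with hεR | hεR
  · exact epsApproximates_of_lt ⟨id, LipschitzWith.id⟩ hT hC₁ hγ₁ hεR 1 1 D 2 M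
  rintro F ⟨F₀, f, S, xmin, htask, hΛ, happ₀, happ, rfl⟩
  have hδ : 0 < ε / k := by positivity
  obtain ⟨σ₀, hσ₀, p₀, A₀, b₀, a₀, c₀, hA₀, hb₀, ha₀, hc₀, hp₀, hF₀⟩ := happ₀.exists_shallow hδ
  choose σ hσ p A b a c hA hb ha hc hp hF using fun i => (happ i).exists_shallow hδ
  obtain ⟨H, hH, hHF⟩ := exists_multihead_approximation hT hD htask.mapsTo_comp (htask.nonempty hT) hΛ hδ hδ
    hσ₀ hA₀ hb₀ ha₀ hc₀ hF₀ hσ hF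
  refine ⟨H, hypothesisClass_mono ?_ hH, _, ?_, hHF⟩
  · have hεg : 0 < ε ^ max γ₁ γ₂ := by positivity
    have e₀ : 1 ≤ K₀ / ε ^ max γ₁ γ₂ := by simpa using h₀ ε hε hεR
    have e₁ : (p₀ : ℝ) ≤ K₁ / ε ^ max γ₁ γ₂ := hp₀.trans (h₁ ε hε hεR)
    have e₂ : (∑ i, (p i : ℝ)) ≤ D * (K₂ / ε ^ max γ₁ γ₂) :=
      (Finset.sum_le_sum fun i _ => (hp i).trans (h₂ ε hε hεR)).trans_eq (by simp)
    have : (((((∑ i, p i) + D) * (d + T + 1 + D * 2) + D * 2 +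
        (p₀ * (3 * D * (D * 2 + 2)) + 1) : ℕ) : ℝ)) ≤ M := by
      refine le_trans ?_ hM.le
      push_cast
      calc ((∑ i, (p i : ℝ)) + D) * (d + T + 1 + D * 2) + D * 2 + (p₀ * (3 * D * (D * 2 + 2)) + 1)
          = ((∑ i, (p i : ℝ)) + D * 1) * (d + T + 1 + D * 2) + D * 2 * 1 +
            (p₀ * (3 * D * (D * 2 + 2)) + 1) := by ring
        _ ≤ (D * (K₂ / ε ^ max γ₁ γ₂) + D * (K₀ / ε ^ max γ₁ γ₂)) * (d + T + 1 + D * 2) +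
            D * 2 * (K₀ / ε ^ max γ₁ γ₂) +
            (K₁ / ε ^ max γ₁ γ₂ * (3 * D * (D * 2 + 2)) + K₀ / ε ^ max γ₁ γ₂) + 0 := by
            rw [add_zero]
            gcongr
        _ ≤ (D * (K₂ / ε ^ max γ₁ γ₂) + D * (K₀ / ε ^ max γ₁ γ₂)) * (d + T + 1 + D * 2) +
            D * 2 * (K₀ / ε ^ max γ₁ γ₂) +
            (K₁ / ε ^ max γ₁ γ₂ * (3 * D * (D * 2 + 2)) + K₀ / ε ^ max γ₁ γ₂) +
            1 / ε ^ max γ₁ γ₂ := by gcongr; positivity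
        _ = _ := by ring
    exact_mod_cast this
  · have : ε / k + Λ * (2 * (ε / k) + ε / k) = ε * ((1 + 3 * Λ) / k) := by ring
    rw [this]
    refine mul_lt_of_lt_one_right hε ?_
    rw [div_lt_one hk0, hk]
    linarith [Λ.2]


/-! ### One head of large dimension -/

lemma relu_nonneg (u : ℝ) : 0 ≤ relu u := le_max_right _ _

lemma relu_mul {k : ℝ} (hk : 0 ≤ k) (u : ℝ) : relu (k * u) = k * relu u := by
  simp only [relu]
  rw [mul_max_of_nonneg _ _ hk, mul_zero]

/-! ### Minima by two ReLU layers. -/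

/-- The minimum of `φ` over `S`, computed with precision `1 / N` by two ReLU layers. -/
noncomputable def reluMin (N : ℕ) {T : ℕ} (S : Finset (Fin T)) (φ : Fin T → ℝ) : ℝ :=
  ∑ k : Fin N, relu (1 / N - ∑ t ∈ S, relu (((k : ℕ) + 1) / N - φ t))

lemma reluMin_mem (N : ℕ) {T : ℕ} (S : Finset (Fin T)) (φ : Fin T → ℝ) :
    reluMin N S φ ∈ Set.Icc (0 : ℝ) 1 := by
  refine ⟨Finset.sum_nonneg fun _ _ => relu_nonneg _, ?_⟩
  calc reluMin N S φ ≤ ∑ k : Fin N, (1 / N : ℝ) := by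
        refine Finset.sum_le_sum fun k _ => max_le ?_ (by positivity)
        linarith [Finset.sum_nonneg fun t (_ : t ∈ S) => relu_nonneg (((k : ℕ) + 1) / N - φ t)]
    _ ≤ 1 := by
        simp only [Finset.sum_const, Finset.card_univ, Fintype.card_fin, nsmul_eq_mul, mul_one_div]
        exact div_self_le_one _

/-- The `k`-th summand is `1 / N` when all values over `S` are at least `(k + 1) / N` and vanishes
when some value is at most `k / N`. The sum therefore counts the grid cells below the minimum.
Values of `φ` outside `[0, 1]` do no harm because the minimum of `f` lies in that interval. -/
lemma abs_reluMin_sub_le {N : ℕ} (hN : 1 ≤ N) {T : ℕ} {S : Finset (Fin T)} (hS : S.Nonempty)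
    (φ f : Fin T → ℝ) (hf : ∀ t, f t ∈ Set.Icc (0 : ℝ) 1) {δ : ℝ} (h : ∀ t, |φ t - f t| ≤ δ) :
    |reluMin N S φ - ⨅ t : {t // t ∈ S}, f t| ≤ δ + 1 / N := by
  have hN0 : (0 : ℝ) < N := by exact_mod_cast hN
  obtain ⟨hle, t₀, ht₀, hm⟩ := iInf_mem_eq φ hS
  have hdist := abs_le.1 (abs_iInf_sub_iInf_le φ f hS h)
  have hmem := iInf_mem_Icc f hS hf
  set m := ⨅ t : {t // t ∈ S}, φ t
  set μ := ⨅ t : {t // t ∈ S}, f t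
  have hδ : 0 ≤ δ := (abs_nonneg _).trans (h t₀)
  have hN1 : (0 : ℝ) < 1 / N := by positivity
  -- Keeping only the minimizing position in the inner sum, each summand is at most the increment of
  -- `min m` over its own cell, and the increments telescope.
  have hup : reluMin N S φ ≤ min m 1 - min m 0 := by
    have htel := Finset.sum_range_sub (fun k : ℕ => min m ((k : ℝ) / N)) N
    rw [div_self hN0.ne', Nat.cast_zero, zero_div] at htel
    rw [← htel, ← Fin.sum_univ_eq_sum_range
      (fun k : ℕ => min m (((k + 1 : ℕ) : ℝ) / N) - min m ((k : ℝ) / N))]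
    refine Finset.sum_le_sum fun k _ => ?_
    have h1 : relu (((k : ℕ) + 1) / N - m) ≤ ∑ t ∈ S, relu (((k : ℕ) + 1) / N - φ t) := by
      rw [← hm]
      exact Finset.single_le_sum (f := fun t => relu (((k : ℕ) + 1) / N - φ t))
        (fun t _ => relu_nonneg _) ht₀
    have h2 : ((k : ℕ) + 1 : ℝ) / N = (k : ℕ) / N + 1 / N := add_div _ _ _
    have h3 : ((k : ℕ) + 1 : ℝ) / N - m ≤ relu (((k : ℕ) + 1) / N - m) := le_max_left _ _
    have h4 := relu_nonneg (((k : ℕ) + 1) / N - m)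
    push_cast
    refine max_le ?_ ?_
    · rcases le_total m (((k : ℕ) : ℝ) / N) with h5 | h5
      · rw [min_eq_left h5, min_eq_left (by linarith)]; linarith
      · rw [min_eq_right h5]
        rcases le_total m ((((k : ℕ) : ℝ) + 1) / N) with h6 | h6
        · rw [min_eq_left h6]; linarith
        · rw [min_eq_right h6]; linarith
    · exact sub_nonneg.2 (min_le_min_left _ (by linarith))
  -- Below, each summand is compared with the increment over the next cell; this shift costs the
  -- error `1 / N`.
  have hlow : min m (1 + 1 / N) - 1 / N ≤ reluMin N S φ := by
    have htel := Finset.sum_range_sub (fun k : ℕ => min m (((k : ℝ) + 1) / N)) N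
    rw [add_div (N : ℝ), div_self hN0.ne', Nat.cast_zero, zero_add] at htel
    have h1 : min m (1 + 1 / N) - 1 / N ≤ min m (1 + 1 / N) - min m (1 / N) := by
      linarith [min_le_right m (1 / N : ℝ)]
    refine h1.trans ?_
    rw [← htel, ← Fin.sum_univ_eq_sum_range
      (fun k : ℕ => min m ((((k + 1 : ℕ) : ℝ) + 1) / N) - min m (((k : ℝ) + 1) / N))]
    refine Finset.sum_le_sum fun k _ => ?_
    rcases le_total m ((((k : ℕ) : ℝ) + 1) / N) with h5 | h5
    · rw [min_eq_left h5, min_eq_left (h5.trans (by push_cast; gcongr; linarith)), sub_self]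
      exact relu_nonneg _
    · have h6 : ∑ t ∈ S, relu (((k : ℕ) + 1) / N - φ t) = 0 :=
        Finset.sum_eq_zero fun t ht => max_eq_right (by linarith [hle t ht])
      rw [h6, min_eq_right h5, sub_zero]
      refine le_trans ?_ (le_max_left _ _)
      have h7 := min_le_right m ((((k : ℕ) + 1 : ℕ) + 1 : ℝ) / N)
      have h8 : ((((k : ℕ) + 1 : ℕ) + 1 : ℝ) / N) = ((k : ℕ) + 1) / N + 1 / N := by
        push_cast; exact add_div _ _ _
      linarith
  rw [abs_le]
  constructor
  · rcases le_total m (1 + 1 / N) with h5 | h5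
    · rw [min_eq_left h5] at hlow; linarith
    · rw [min_eq_right h5] at hlow; linarith [hmem.2]
  · have h6 := min_le_left m 1
    rcases le_total m 0 with h5 | h5
    · rw [min_eq_left h5] at hup; linarith [hmem.1]
    · rw [min_eq_right h5] at hup; linarith

/-! ### The transformer with a single averaging head. -/

lemma sum_extend_mul {α β : Type*} [Fintype α] [Fintype β] (f : α → β) (hf : Function.Injective f)
    (A : α → ℝ) (y : β → ℝ) :
    ∑ q, Function.extend f A 0 q * y q = ∑ j, A j * y (f j) := by
  classical
  have h1 : ∑ j, A j * y (f j) = ∑ q ∈ Finset.univ.image f, Function.extend f A 0 q * y q := by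
    rw [Finset.sum_image fun _ _ _ _ h => hf h]
    exact Finset.sum_congr rfl fun j _ => by rw [hf.extend_apply]
  rw [h1]
  refine (Finset.sum_subset (Finset.subset_univ _) fun q _ hq => ?_).symm
  rw [Function.extend_apply' _ _ _ (fun ⟨j, hj⟩ => hq (by simp [← hj]))]
  simp

/-- The attention layer that averages all tokens. -/
noncomputable def meanAttention (n : ℕ) : Attention 1 n where
  WQ := 0
  WK := 0
  WV i r q := if q = finProdFinEquiv (i, r) then 1 else 0
  WO := 1
  c₀ := 0
  β := 1

lemma meanAttention_admissible (n : ℕ) : (meanAttention n).Admissible := by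
  refine ⟨one_pos, fun i r j => ?_, fun i r j => ?_, fun i r j => ?_, fun r j => ?_⟩
  · simp [meanAttention]
  · simp [meanAttention]
  · simp only [meanAttention]; split_ifs <;> simp
  · simp only [meanAttention, Matrix.one_apply]; split_ifs <;> simp

lemma meanAttention_out (n : ℕ) {T : ℕ} (e : Fin T → Fin (1 * n) → ℝ) (q : Fin (1 * n)) :
    (meanAttention n).out e q = 1 / T * ∑ t, e t q := by
  have hV : ∀ i r t, ((meanAttention n).WV i *ᵥ e t) r = e t (finProdFinEquiv (i, r)) := by
    intro i r t
    simp [meanAttention, Matrix.mulVec, dotProduct]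
  have hO : (meanAttention n).WO *ᵥ (meanAttention n).concatHeads e =
      (meanAttention n).concatHeads e := by
    simp [meanAttention]
  have hc : (meanAttention n).c₀ = 0 := rfl
  have hsm : ∀ t : Fin T, softmax (meanAttention n).β (fun _ => (0 : ℝ)) t = (1 / T : ℝ) := by
    intro t
    simp [softmax]
  have hK : ∀ i, (meanAttention n).WK i = 0 := fun _ => rfl
  rw [Attention.out, hO, hc, zero_add, Attention.concatHeads, Attention.head]
  simp only [hK, Matrix.zero_mulVec, dotProduct_zero, hsm, Finset.sum_apply, Pi.smul_apply, hV,
    smul_eq_mul, Prod.mk.eta, Equiv.apply_symm_apply, ← Finset.mul_sum]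

/-- The encoder that writes the token at position `t` into the `t`-th block of coordinates. -/
lemma exists_block_encoder {d T E : ℕ} (emb : Fin T × Fin d → Fin E) (hemb : Function.Injective emb)
    (s : ℝ) :
    ∃ P : FFN E 2 (d + T), P.paramCount ≤ T * d * (d + T) + T * d + T * d ∧
      ∀ x ∈ cube d, ∀ t : Fin T,
        encode relu P x t = Function.extend emb (fun k => if k.1 = t then s * x k.2 else 0) 0 := by
  classical
  -- Only `T * d` output weights are nonzero, so the count does not depend on the embedding
  -- dimension `E`.
  have hout : Realizes relu Set.univ 1 (T * d)
      (fun (h : Fin T × Fin d → ℝ) q => ∑ k, (if emb k = q then s else 0) * h k + 0) := by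
    refine Realizes.output (fun q (k : Fin T × Fin d) => if emb k = q then s else 0) 0
      (fun _ _ => Set.mem_univ _) (fun _ => Set.mem_univ _) ?_
    have h1 : Set.ncard {q : Fin E × Fin T × Fin d | (if emb q.2 = q.1 then s else 0) ≠ 0} ≤ T * d := by
      refine (ncard_le_card_of_subset_range (fun k : Fin T × Fin d => (emb k, k)) ?_).trans_eq
        (by simp)
      rintro ⟨q, k⟩ h
      exact ⟨k, by simpa using (ite_ne_right_iff.1 h).1⟩
    have h2 : Set.ncard {r : Fin E | (0 : Fin E → ℝ) r ≠ 0} = 0 := by simp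
    exact add_le_add h1 h2.le
  obtain ⟨P, -, hP, hev⟩ := Realizes.layer (ι := Fin d ⊕ Fin T) (κ := Fin T × Fin d)
    (fun k => Sum.elim (Pi.single k.2 (1 : ℝ)) (Pi.single k.1 (1 : ℝ))) (fun _ => (-1 : ℝ))
    (fun _ _ => Set.mem_univ _) (fun _ => Set.mem_univ _) (entryCount_le _ _) hout
    (d + T) finSumFinEquiv
  refine ⟨P, hP.trans_eq (by simp), fun x hx t => ?_⟩
  have hin : ∀ e : Fin d ⊕ Fin T, (Fin.append x (Pi.single t (1 : ℝ)) : Fin (d + T) → ℝ)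
      (finSumFinEquiv e) = Sum.elim x (Pi.single t 1) e := by
    rintro (j | t') <;> simp
  -- The preactivation is a coordinate of the token plus a position indicator minus 1: at the
  -- matching position the coordinate in `[0, 1]` survives, elsewhere the value is nonpositive.
  have hrelu : ∀ k : Fin T × Fin d, relu (∑ j : Fin d ⊕ Fin T,
      Sum.elim (Pi.single k.2 (1 : ℝ)) (Pi.single k.1 (1 : ℝ)) j *
        (Fin.append x (Pi.single t (1 : ℝ)) : Fin (d + T) → ℝ) (finSumFinEquiv j) + -1) =
      if k.1 = t then x k.2 else 0 := by
    intro k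
    simp only [hin, Fintype.sum_sum_type, Sum.elim_inl, Sum.elim_inr]
    have e1 : ∑ j, (Pi.single k.2 (1 : ℝ) : Fin d → ℝ) j * x j = x k.2 := by
      simp [Pi.single_apply]
    have e2 : ∑ u, (Pi.single k.1 (1 : ℝ) : Fin T → ℝ) u * (Pi.single t (1 : ℝ) : Fin T → ℝ) u =
        if k.1 = t then 1 else 0 := by
      simp [Pi.single_apply, eq_comm]
    rw [e1, e2]
    have h0 : 0 ≤ x k.2 := hx.1 k.2
    have h1 : x k.2 ≤ 1 := hx.2 k.2
    split_ifs
    · rw [add_neg_cancel_right]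
      exact max_eq_left h0
    · exact max_eq_right (by linarith)
  ext q
  simp only [encode, hev, hrelu, add_zero, ite_mul, zero_mul]
  by_cases hq : ∃ k, emb k = q
  · obtain ⟨k, rfl⟩ := hq
    rw [hemb.extend_apply, Finset.sum_eq_single k (fun k' _ hk' => by simp [hemb.eq_iff, hk'])
      (by simp)]
    simp
  · rw [Function.extend_apply' _ _ _ hq]
    exact Finset.sum_eq_zero fun k _ => by
      rw [if_neg fun h => hq ⟨k, h⟩]

/-- A five-layer ReLU block that evaluates shallow networks on the blocks of its input, takes minima
over given sets of blocks, and applies a further shallow network. -/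
lemma exists_retrieval_block {d T D E N K p₀ : ℕ} (emb : Fin T × Fin d → Fin E)
    (hemb : Function.Injective emb) (hN : 1 ≤ N) (hK : 2 ≤ K) (S : Fin D → Finset (Fin T))
    {A₀ : Fin p₀ → Fin D → ℝ} {b₀ a₀ : Fin p₀ → ℝ} {c₀ : ℝ}
    (hA₀ : ∀ r j, A₀ r j ∈ unitWeights) (hb₀ : ∀ r, b₀ r ∈ unitWeights)
    (ha₀ : ∀ r, a₀ r ∈ unitWeights) (hc₀ : c₀ ∈ unitWeights)
    {p : Fin D → ℕ} {A : ∀ i, Fin (p i) → Fin d → ℝ} {b a : ∀ i, Fin (p i) → ℝ} {c : Fin D → ℝ}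
    (hA : ∀ i r j, A i r j ∈ unitWeights) (hb : ∀ i r, b i r ∈ unitWeights)
    (ha : ∀ i r, a i r ∈ unitWeights) (hc : ∀ i, c i ∈ unitWeights) :
    ∃ G : FFN 1 5 E, G.WeightsIn unitWeights ∧
      G.paramCount ≤ (T * (∑ i, p i) * d + T * (∑ i, p i)) +
        ((D * (T * N) * (T * ∑ i, p i) + D * (T * N)) +
        ((D * N * T + D * N) + ((p₀ * K * (D * N) + p₀ * K) + (p₀ * K + 1)))) ∧
      ∀ (y : Fin E → ℝ) (X : Fin T → Fin d → ℝ), (∀ t j, y (emb (t, j)) = 1 / K * X t j) →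
        G.eval relu y 0 = shallow relu A₀ b₀ a₀ c₀ fun i =>
          reluMin N (S i) fun t => shallow relu (A i) (b i) (a i) (c i) (X t) := by
  classical
  have hK0 : (0 : ℝ) < K := by exact_mod_cast (show 0 < K by omega)
  have hK2 : (2 : ℝ) ≤ K := by exact_mod_cast hK
  have hN0 : (0 : ℝ) < N := by exact_mod_cast hN
  have hN1 : (1 : ℝ) ≤ N := by exact_mod_cast hN
  have h0 : (0 : ℝ) ∈ unitWeights := by simp [unitWeights]
  have hneg : ∀ u ∈ unitWeights, -u ∈ unitWeights := fun u hu => by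
    simp only [unitWeights, Set.mem_Icc] at hu ⊢; constructor <;> linarith
  -- By positive homogeneity of ReLU the factor `1 / K` of the input passes through all hidden
  -- layers if the biases carry it too. Since `K ≥ 2`, the biases `(k + 1) / N - c`, of size up to
  -- 2, become admissible.
  have hscale : ∀ u : ℝ, |u| ≤ 2 → 1 / K * u ∈ unitWeights := fun u hu => by
    rw [abs_le] at hu
    simp only [unitWeights, Set.mem_Icc]
    rw [one_div_mul_eq_div, le_div_iff₀ hK0, div_le_iff₀ hK0]
    constructor <;> linarith
  have habs : ∀ u ∈ unitWeights, |u| ≤ 1 := fun u hu => abs_le.2 hu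
  have hlam : (0 : ℝ) ≤ 1 / K := by positivity
  have l₅ : Realizes relu unitWeights 1 (p₀ * K + 1)
      (fun (h : Fin p₀ × Fin K → ℝ) (_ : Fin 1) => ∑ k, a₀ k.1 * h k + c₀) :=
    Realizes.output (fun _ (k : Fin p₀ × Fin K) => a₀ k.1) (fun _ => c₀) (fun _ k => ha₀ _)
      (fun _ => hc₀) ((entryCount_le _ _).trans_eq (by simp))
  -- The weights of `F₀`, repeated over the `N` thresholds, also perform the outer sum of `reluMin`.
  -- The `K` copies of each unit cancel the factor `1 / K` in the output layer.
  have l₄ := Realizes.layer (ι := Fin D × Fin N) (κ := Fin p₀ × Fin K)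
    (fun k q => A₀ k.1 q.1) (fun k => 1 / K * b₀ k.1) (fun k q => hA₀ _ _)
    (fun k => hscale _ ((habs _ (hb₀ _)).trans one_le_two)) (entryCount_le _ _) l₅
  have l₃ := Realizes.layer (ι := Fin D × Fin T × Fin N) (κ := Fin D × Fin N)
    (c := D * N * T + D * N)
    (fun k q => if (q.1 = k.1 ∧ q.2.2 = k.2) ∧ q.2.1 ∈ S k.1 then -1 else 0)
    (fun k => 1 / K * (1 / N))
    (fun k q => by split_ifs; exacts [by simp [unitWeights], h0])
    (fun k => hscale _ (by
      rw [abs_of_pos (by positivity), div_le_iff₀ hN0]; linarith))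
    (by
      refine add_le_add ?_ ((ncard_le_card_of_subset_range id (by simp)).trans_eq
        (by simp : Fintype.card (Fin D × Fin N) = D * N))
      refine (ncard_le_card_of_subset_range
        (fun k : (Fin D × Fin N) × Fin T => (k.1, (k.1.1, k.2, k.1.2))) ?_).trans_eq (by simp)
      rintro ⟨⟨i, k⟩, i', t, k'⟩ h
      have h' : (i' = i ∧ k' = k) ∧ t ∈ S i := (ite_ne_right_iff.1 h).1
      obtain ⟨⟨rfl, rfl⟩, -⟩ := h'
      exact ⟨((i', k'), t), rfl⟩) l₄
  have l₂ := Realizes.layer (ι := Fin T × ((i : Fin D) × Fin (p i))) (κ := Fin D × Fin T × Fin N)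
    (fun k q => if q.1 = k.2.1 ∧ q.2.1 = k.1 then -a q.2.1 q.2.2 else 0)
    (fun k => 1 / K * (((k.2.2 : ℕ) + 1) / N - c k.1))
    (fun k q => by split_ifs; exacts [hneg _ (ha _ _), h0])
    (fun k => hscale _ (by
      have h1 : (((k.2.2 : ℕ) : ℝ) + 1) / N ≤ 1 := by
        rw [div_le_one hN0]
        exact_mod_cast k.2.2.2
      have h2 : 0 ≤ (((k.2.2 : ℕ) : ℝ) + 1) / N := by positivity
      have h3 := abs_le.1 (habs _ (hc k.1))
      rw [abs_le]
      constructor <;> linarith)) (entryCount_le _ _) l₃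
  obtain ⟨G, hGW, hG, hGev⟩ := Realizes.layer (ι := Fin E) (κ := Fin T × ((i : Fin D) × Fin (p i)))
    (c := T * (∑ i, p i) * d + T * (∑ i, p i))
    (fun k => Function.extend (fun j => emb (k.1, j)) (A k.2.1 k.2.2) 0)
    (fun k => 1 / K * b k.2.1 k.2.2)
    (fun k q => by
      by_cases hq : ∃ j, emb (k.1, j) = q
      · obtain ⟨j, rfl⟩ := hq
        rw [Function.Injective.extend_apply (f := fun j => emb (k.1, j))
          (fun j j' h => by simpa using hemb h)]
        exact hA _ _ _
      · rw [Function.extend_apply' _ _ _ hq]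
        exact h0)
    (fun k => hscale _ ((habs _ (hb _ _)).trans one_le_two))
    (by
      refine add_le_add ?_ ((ncard_le_card_of_subset_range id (by simp)).trans_eq
        (by simp : Fintype.card (Fin T × ((i : Fin D) × Fin (p i))) = T * ∑ i, p i))
      refine (ncard_le_card_of_subset_range
        (fun k : (Fin T × ((i : Fin D) × Fin (p i))) × Fin d => (k.1, emb (k.1.1, k.2))) ?_).trans_eq
        (by simp)
      rintro ⟨k, q⟩ h
      by_contra hq
      refine h (Function.extend_apply' _ _ _ ?_)
      rintro ⟨j, hj⟩
      exact hq ⟨(k, j), Prod.ext rfl hj⟩) l₂ E (Equiv.refl _)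
  refine ⟨G, hGW, hG.trans_eq (by simp), fun y X hy => ?_⟩
  rw [hGev]
  have e₁ : ∀ k : Fin T × ((i : Fin D) × Fin (p i)),
      relu (∑ q, Function.extend (fun j => emb (k.1, j)) (A k.2.1 k.2.2) 0 q * y q +
        1 / K * b k.2.1 k.2.2) =
      1 / K * relu (∑ j, A k.2.1 k.2.2 j * X k.1 j + b k.2.1 k.2.2) := by
    intro k
    rw [sum_extend_mul _ fun j j' h => by simpa using hemb h, ← relu_mul hlam, mul_add,
      Finset.mul_sum]
    congr 2
    exact Finset.sum_congr rfl fun j _ => by rw [hy]; ring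
  have e₂ : ∀ k : Fin D × Fin T × Fin N,
      relu (∑ q : Fin T × ((i : Fin D) × Fin (p i)),
        (if q.1 = k.2.1 ∧ q.2.1 = k.1 then -a q.2.1 q.2.2 else 0) *
          (1 / K * relu (∑ j, A q.2.1 q.2.2 j * X q.1 j + b q.2.1 q.2.2)) +
        1 / K * (((k.2.2 : ℕ) + 1) / N - c k.1)) =
      1 / K * relu (((k.2.2 : ℕ) + 1) / N - shallow relu (A k.1) (b k.1) (a k.1) (c k.1) (X k.2.1)) := by
    rintro ⟨i, t, k⟩
    rw [← relu_mul hlam]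
    congr 1
    simp only [Fintype.sum_prod_type, Fintype.sum_sigma]
    rw [Finset.sum_eq_single t (fun t' _ ht' => by simp [ht']) (by simp),
      Finset.sum_eq_single i (fun i' _ hi' => by simp [hi']) (by simp)]
    simp only [and_self, if_true, shallow, neg_mul, Finset.sum_neg_distrib]
    rw [show ∑ r, a i r * (1 / K * relu (∑ j, A i r j * X t j + b i r)) =
      1 / K * ∑ r, a i r * relu (∑ j, A i r j * X t j + b i r) by
        rw [Finset.mul_sum]; exact Finset.sum_congr rfl fun r _ => by ring]
    ring
  have e₃ : ∀ k : Fin D × Fin N,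
      relu (∑ q : Fin D × Fin T × Fin N,
        (if (q.1 = k.1 ∧ q.2.2 = k.2) ∧ q.2.1 ∈ S k.1 then (-1 : ℝ) else 0) *
          (1 / K * relu (((q.2.2 : ℕ) + 1) / N -
            shallow relu (A q.1) (b q.1) (a q.1) (c q.1) (X q.2.1))) + 1 / K * (1 / N)) =
      1 / K * relu (1 / N - ∑ t ∈ S k.1, relu (((k.2 : ℕ) + 1) / N -
            shallow relu (A k.1) (b k.1) (a k.1) (c k.1) (X t))) := by
    rintro ⟨i, k⟩
    rw [← relu_mul hlam]
    congr 1
    simp only [Fintype.sum_prod_type]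
    rw [Finset.sum_eq_single i (fun i' _ hi' => by simp [hi']) (by simp)]
    have : ∀ t : Fin T, ∑ k' : Fin N, (if (i = i ∧ k' = k) ∧ t ∈ S i then (-1 : ℝ) else 0) *
        (1 / K * relu (((k' : ℕ) + 1) / N - shallow relu (A i) (b i) (a i) (c i) (X t))) =
        if t ∈ S i then
          -(1 / K * relu (((k : ℕ) + 1) / N - shallow relu (A i) (b i) (a i) (c i) (X t))) else 0 := by
      intro t
      rw [Finset.sum_eq_single k (fun k' _ hk' => by simp [hk']) (by simp)]
      by_cases ht : t ∈ S i <;> simp [ht]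
    rw [Finset.sum_congr rfl fun t _ => this t, ← Finset.sum_filter, Finset.filter_univ_mem, Finset.sum_neg_distrib, ← Finset.mul_sum]
    ring
  have e₄ : ∀ k : Fin p₀ × Fin K,
      relu (∑ q : Fin D × Fin N, A₀ k.1 q.1 *
        (1 / K * relu (1 / N - ∑ t ∈ S q.1, relu (((q.2 : ℕ) + 1) / N -
            shallow relu (A q.1) (b q.1) (a q.1) (c q.1) (X t)))) + 1 / K * b₀ k.1) =
      1 / K * relu (∑ i, A₀ k.1 i * reluMin N (S i)
        (fun t => shallow relu (A i) (b i) (a i) (c i) (X t)) + b₀ k.1) := by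
    rintro ⟨r, k⟩
    rw [← relu_mul hlam, mul_add, Finset.mul_sum]
    congr 2
    simp only [Fintype.sum_prod_type, reluMin, Finset.mul_sum]
    refine Finset.sum_congr rfl fun i _ => Finset.sum_congr rfl fun k _ => by ring
  simp only [Equiv.refl_apply, e₁, e₂, e₃, e₄]
  simp only [Fintype.sum_prod_type, Finset.sum_const, Finset.card_univ, Fintype.card_fin,
    nsmul_eq_mul]
  rw [shallow]
  congr 1
  refine Finset.sum_congr rfl fun r _ => ?_
  field_simp

/-- The encoder scale `1 / (2 * d)` ensures the norm bound, and averaging contributes `1 / T`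
because only position `t` writes to block `t`. Together they give the contraction `1 / K` with `K =
2 * (d * T)`. -/
lemma exists_single_head_approximation {d T D n N p₀ : ℕ} (hd : 1 ≤ d) (hT : 1 ≤ T) (hn : T * d ≤ n)
    (hN : 1 ≤ N) {F₀ : (Fin D → ℝ) → ℝ} {f : Fin D → (Fin d → ℝ) → ℝ} {S : Fin D → Finset (Fin T)}
    (hf : ∀ i, Set.MapsTo (f i) (cube d) (Set.Icc 0 1)) (hS : ∀ i, (S i).Nonempty) {Λ : ℝ≥0}
    (hΛ : LipschitzOnWith Λ F₀ (cube D)) {δ : ℝ} (hδ : 0 < δ)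
    {A₀ : Fin p₀ → Fin D → ℝ} {b₀ a₀ : Fin p₀ → ℝ} {c₀ : ℝ}
    (hA₀ : ∀ r j, A₀ r j ∈ unitWeights) (hb₀ : ∀ r, b₀ r ∈ unitWeights)
    (ha₀ : ∀ r, a₀ r ∈ unitWeights) (hc₀ : c₀ ∈ unitWeights)
    (h₀ : ∀ z ∈ cube D, |F₀ z - shallow relu A₀ b₀ a₀ c₀ z| ≤ δ)
    {p : Fin D → ℕ} {A : ∀ i, Fin (p i) → Fin d → ℝ} {b a : ∀ i, Fin (p i) → ℝ} {c : Fin D → ℝ}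
    (hA : ∀ i r j, A i r j ∈ unitWeights) (hb : ∀ i r, b i r ∈ unitWeights)
    (ha : ∀ i r, a i r ∈ unitWeights) (hc : ∀ i, c i ∈ unitWeights)
    (h : ∀ i, ∀ x ∈ cube d, |f i x - shallow relu (A i) (b i) (a i) (c i) x| ≤ δ) :
    ∃ H ∈ hypothesisClass {relu} 2 5 1 n d T
      ((T * d * (d + T) + T * d + T * d) + ((T * (∑ i, p i) * d + T * (∑ i, p i)) +
        ((D * (T * N) * (T * ∑ i, p i) + D * (T * N)) +
        ((D * N * T + D * N) +
          ((p₀ * (2 * (d * T)) * (D * N) + p₀ * (2 * (d * T))) + (p₀ * (2 * (d * T)) + 1)))))),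
      ∀ X ∈ inputSpace d T, |H X - retrievalTarget F₀ f S X| ≤ δ + Λ * (δ + 1 / N) := by
  obtain ⟨emb⟩ : Nonempty (Fin T × Fin d ↪ Fin (1 * n)) :=
    Function.Embedding.nonempty_of_card_le (by simpa using hn)
  have hd1 : (1 : ℝ) ≤ d := by exact_mod_cast hd
  have hd0 : (0 : ℝ) < d := by linarith
  have hT0 : (0 : ℝ) < T := by exact_mod_cast hT
  have hdT : 1 ≤ d * T := Nat.mul_pos hd hT
  obtain ⟨P, hP, hPev⟩ := exists_block_encoder (d := d) (T := T) emb emb.injective (1 / (2 * d))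
  obtain ⟨G, hGW, hG, hGev⟩ := exists_retrieval_block (d := d) (T := T) (K := 2 * (d * T)) emb
    emb.injective hN (by omega) S hA₀ hb₀ ha₀ hc₀ hA hb ha hc
  refine ⟨_, ⟨relu, rfl, relu, rfl, P, meanAttention n, G, fun x hx t => ?_,
    meanAttention_admissible n, hGW, add_le_add hP hG, rfl⟩, fun X hX => ?_⟩
  · rw [Real.sqrt_le_left zero_le_one, one_pow, hPev x hx t]
    simp only [sq]
    rw [sum_extend_mul _ emb.injective]
    simp only [emb.injective.extend_apply, Fintype.sum_prod_type]
    rw [Finset.sum_eq_single t (fun t' _ ht' => by simp [ht']) (by simp)]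
    simp only [if_true]
    calc ∑ j, 1 / (2 * d) * x j * (1 / (2 * d) * x j) ≤ ∑ j : Fin d, (1 / d : ℝ) := by
          refine Finset.sum_le_sum fun j _ => ?_
          have h0 : 0 ≤ x j := hx.1 j
          have h1 : x j ≤ 1 := hx.2 j
          have h2 : 1 / (2 * d) * x j ≤ 1 := by
            rw [one_div_mul_eq_div, div_le_one (by positivity)]; linarith
          have h3 : 1 / (2 * d) * x j ≤ 1 / d := by
            rw [one_div_mul_eq_div, div_le_div_iff₀ (by positivity) hd0]; nlinarith
          calc _ ≤ 1 * (1 / d : ℝ) := by gcongr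
            _ = _ := one_mul _
      _ = 1 := by simp [hd0.ne']
  · have hy : ∀ t j, (meanAttention n).out (fun t => encode relu P (X t) t) (emb (t, j)) =
        1 / ((2 * (d * T) : ℕ) : ℝ) * X t j := by
      intro t j
      rw [meanAttention_out]
      simp only [fun t' => hPev _ (hX t') t', emb.injective.extend_apply]
      rw [Finset.sum_eq_single t (fun t' _ ht' => by simp [ht'.symm]) (by simp)]
      simp only [if_true]
      push_cast
      field_simp
    simp only [hGev _ X hy]
    set z : Fin D → ℝ := fun i =>
      reluMin N (S i) fun t => shallow relu (A i) (b i) (a i) (c i) (X t) with hz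
    have hzc : z ∈ cube D := by
      rw [cube, Set.mem_Icc, Pi.le_def, Pi.le_def]
      exact ⟨fun i => (reluMin_mem _ _ _).1, fun i => (reluMin_mem _ _ _).2⟩
    set y : Fin D → ℝ := fun i => ⨅ t : {t // t ∈ S i}, f i (X t) with hy
    have hyc : y ∈ cube D := by
      rw [cube, Set.mem_Icc, Pi.le_def, Pi.le_def]
      have := fun i => iInf_mem_Icc _ (hS i) fun t => hf i (hX t)
      exact ⟨fun i => (this i).1, fun i => (this i).2⟩
    have hdist : dist z y ≤ δ + 1 / N := by
      refine (dist_pi_le_iff (by positivity)).2 fun i => ?_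
      rw [Real.dist_eq]
      exact abs_reluMin_sub_le hN (hS i) _ (fun t => f i (X t)) (fun t => hf i (hX t)) fun t => by
        rw [abs_sub_comm]; exact h i _ (hX t)
    have h1 := h₀ z hzc
    have h2 := hΛ.dist_le_mul z hzc y hyc
    rw [Real.dist_eq] at h2
    have h3 : (Λ : ℝ) * dist z y ≤ Λ * (δ + 1 / N) := by gcongr
    rw [abs_sub_comm] at h1
    calc |shallow relu A₀ b₀ a₀ c₀ z - F₀ y| ≤ _ := abs_sub_le _ (F₀ z) _
      _ ≤ δ + Λ * (δ + 1 / N) := by linarith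

theorem single_head_upper_bound {d T D : ℕ} (hd : 1 ≤ d) (hT : 1 ≤ T) (C₁ γ₁ C₂ γ₂ : ℝ)
    (Λ : ℝ≥0) (hC₁ : 0 < C₁) (hγ₁ : 0 < γ₁) (hC₂ : 0 < C₂) :
    ∃ C : ℝ, 0 < C ∧ ∀ n : ℕ, T * d ≤ n → ∀ ε : ℝ, 0 < ε → ∀ M : ℕ, C / ε ^ (1 + max γ₁ γ₂) < M →
      EpsApproximates (hypothesisClass {relu} 2 5 1 n d T M) ε
        (approxTargetClass {relu} unitWeights d T D C₁ γ₁ C₂ γ₂ Λ) := by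
  set R : ℝ := 1 + (C₁ + 1) ^ (1 / γ₁) with hR
  have hR0 : 0 < R := by positivity
  set k : ℝ := 2 + 4 * Λ with hk
  have hk0 : 0 < k := by positivity
  obtain ⟨K₁, hK₁, h₁⟩ := exists_div_rpow_le hC₁.le hk0 hR0 (le_max_left γ₁ γ₂)
  obtain ⟨K₂, hK₂, h₂⟩ := exists_div_rpow_le hC₂.le hk0 hR0 (le_max_right γ₁ γ₂)
  obtain ⟨K₀, hK₀, h₀⟩ := exists_div_rpow_le (zero_le_one' ℝ) hk0 hR0
    (hγ₁.le.trans (le_max_left γ₁ γ₂))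
  set B : ℕ := (T * d * (d + T) + T * d + T * d) + ((T * d + T) + ((D * T * T + D * T) +
    ((D * T + D) + ((2 * (d * T) * D + 2 * (d * T)) + (2 * (d * T) + 1))))) with hB
  refine ⟨B * ((k + 2 * R) * (K₁ + D * K₂ + K₀)) + 1, by positivity, fun n hn ε hε M hM => ?_⟩
  rcases lt_or_ge R ε with hεR | hεR
  · exact epsApproximates_of_lt ⟨relu, Set.mem_singleton _⟩ hT hC₁ hγ₁ hεR 1 4 1 n M
  rintro F ⟨F₀, f, S, xmin, htask, hΛ, happ₀, happ, rfl⟩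
  have hδ : 0 < ε / k := by positivity
  obtain ⟨σ₀, rfl, p₀, A₀, b₀, a₀, c₀, hA₀, hb₀, ha₀, hc₀, hp₀, hF₀⟩ := happ₀.exists_shallow hδ
  choose σ hσ p A b a c hA hb ha hc hp hF using fun i => (happ i).exists_shallow hδ
  obtain rfl : σ = fun _ => relu := funext hσ
  set N : ℕ := ⌈k / ε⌉₊ with hN
  have hN1 : 1 ≤ N := Nat.one_le_ceil_iff.2 (by positivity)
  have hNle : 1 / (N : ℝ) ≤ ε / k := by
    rw [div_le_div_iff₀ (by exact_mod_cast hN1) hk0]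
    have := (div_le_iff₀ hε).1 (Nat.le_ceil (k / ε))
    linarith
  obtain ⟨H, hH, hHF⟩ := exists_single_head_approximation hd hT hn hN1 htask.mapsTo_comp
    (htask.nonempty hT) hΛ hδ hA₀ hb₀ ha₀ hc₀ hF₀ hA hb ha hc hF
  refine ⟨H, hypothesisClass_mono ?_ hH, _, ?_, hHF⟩
  · set s : ℕ := ∑ i, p i with hs
    -- `Z` dominates each of the monomials `1`, `N`, `s`, `N * s`, `p₀`, `p₀ * N` of the parameter
    -- count, and `B` is the sum of their coefficients. Its factors are of order `1 / ε` and `1 / ε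
    -- ^ max γ₁ γ₂`.
    set Z : ℕ := (N + 1) * (p₀ + s + 1) with hZ
    have z₁ : 1 ≤ Z := by rw [hZ]; nlinarith
    have z₂ : N ≤ Z := by rw [hZ]; nlinarith
    have z₃ : s ≤ Z := by rw [hZ]; nlinarith
    have z₄ : N * s ≤ Z := by rw [hZ]; nlinarith
    have z₅ : p₀ ≤ Z := by rw [hZ]; nlinarith
    have z₆ : p₀ * N ≤ Z := by rw [hZ]; nlinarith
    have hle : (T * d * (d + T) + T * d + T * d) + ((T * s * d + T * s) +
        ((D * (T * N) * (T * s) + D * (T * N)) + ((D * N * T + D * N) +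
          ((p₀ * (2 * (d * T)) * (D * N) + p₀ * (2 * (d * T))) + (p₀ * (2 * (d * T)) + 1))))) ≤
        B * Z := by
      calc _ = (T * d * (d + T) + T * d + T * d) * 1 + ((T * d + T) * s +
            ((D * T * T * (N * s) + D * T * N) + ((D * T + D) * N +
            ((2 * (d * T) * D * (p₀ * N) + 2 * (d * T) * p₀) + (2 * (d * T) * p₀ + 1 * 1))))) := by
              ring
        _ ≤ (T * d * (d + T) + T * d + T * d) * Z + ((T * d + T) * Z +
            ((D * T * T * Z + D * T * Z) + ((D * T + D) * Z +
            ((2 * (d * T) * D * Z + 2 * (d * T) * Z) + (2 * (d * T) * Z + 1 * Z))))) := by gcongr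
        _ = B * Z := by rw [hB]; ring
    refine hle.trans ?_
    have hεg : 0 < ε ^ max γ₁ γ₂ := by positivity
    have e₀ : 1 ≤ K₀ / ε ^ max γ₁ γ₂ := by simpa using h₀ ε hε hεR
    have e₁ : (p₀ : ℝ) ≤ K₁ / ε ^ max γ₁ γ₂ := hp₀.trans (h₁ ε hε hεR)
    have e₂ : (s : ℝ) ≤ D * (K₂ / ε ^ max γ₁ γ₂) := by
      rw [hs]
      push_cast
      exact (Finset.sum_le_sum fun i _ => (hp i).trans (h₂ ε hε hεR)).trans_eq (by simp)
    have e₃ : (N : ℝ) + 1 ≤ (k + 2 * R) / ε := by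
      have h1 : (N : ℝ) < k / ε + 1 := Nat.ceil_lt_add_one (by positivity)
      have h2 : 1 ≤ R / ε := (one_le_div hε).2 hεR
      have h3 : (k + 2 * R) / ε = k / ε + 2 * (R / ε) := by ring
      linarith
    have : ((B * Z : ℕ) : ℝ) ≤ M := by
      refine le_trans ?_ hM.le
      rw [hZ]
      push_cast
      calc (B : ℝ) * ((N + 1) * (p₀ + s + 1)) ≤ B * ((k + 2 * R) / ε *
            (K₁ / ε ^ max γ₁ γ₂ + D * (K₂ / ε ^ max γ₁ γ₂) + K₀ / ε ^ max γ₁ γ₂)) := by gcongr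
        _ = B * ((k + 2 * R) * (K₁ + D * K₂ + K₀)) / ε ^ (1 + max γ₁ γ₂) := by
            rw [Real.rpow_add hε, Real.rpow_one]
            field_simp
        _ ≤ _ := by gcongr; linarith
    exact_mod_cast this
  · calc ε / k + Λ * (ε / k + 1 / N) ≤ ε / k + Λ * (ε / k + ε / k) := by gcongr
      _ = ε * ((1 + 2 * Λ) / k) := by ring
      _ < ε := by
        refine mul_lt_of_lt_one_right hε ?_
        rw [div_lt_one hk0, hk]
        linarith [Λ.2]


/-! ### Fewer heads than components -/

/-! ### Local behaviour of a target near its minimal values. -/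

lemma uniqueDiffOn_cube (m : ℕ) : UniqueDiffOn ℝ (cube m) := by
  have : cube m = Set.pi Set.univ fun _ => Set.Icc (0 : ℝ) 1 := by
    rw [Set.pi_univ_Icc]; rfl
  rw [this]
  exact UniqueDiffOn.univ_pi fun _ => uniqueDiffOn_Icc_zero_one

/-- A `C¹` function on the cube with a nonvanishing partial derivative separates nearby points that
differ in that coordinate. -/
lemma exists_slope {D : ℕ} {F₀ : (Fin D → ℝ) → ℝ} (h : ContDiffOn ℝ 1 F₀ (cube D)) {z : Fin D → ℝ}
    (hz : z ∈ cube D) (i : Fin D) (hne : fderivWithin ℝ F₀ (cube D) z (Pi.single i 1) ≠ 0) :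
    ∃ κ > 0, ∃ ρ > 0, ∀ u v : ℝ, u ∈ Set.Icc 0 ρ → v ∈ Set.Icc 0 ρ → z i + u ≤ 1 → z i + v ≤ 1 →
      κ * |u - v| ≤
        |F₀ (Function.update z i (z i + u)) - F₀ (Function.update z i (z i + v))| := by
  set L := fderivWithin ℝ F₀ (cube D) z with hL
  set s : ℝ := |L (Pi.single i 1)| with hs
  have hs0 : 0 < s := abs_pos.2 hne
  have hcont := h.continuousOn_fderivWithin (uniqueDiffOn_cube D) le_rfl z hz
  -- Within this radius the derivative differs from `L` by at most half the slope `s`. The mean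
  -- value inequality on the convex set `cube D ∩ ball z r` then leaves at least the slope `s / 2`.
  obtain ⟨r, hr, hball⟩ := Metric.continuousWithinAt_iff.1 hcont (s / 2) (by positivity)
  refine ⟨s / 2, by positivity, r / 2, by positivity, fun u v hu hv hu1 hv1 => ?_⟩
  have hmem : ∀ w ∈ Set.Icc (0 : ℝ) (r / 2), z i + w ≤ 1 →
      Function.update z i (z i + w) ∈ cube D ∩ Metric.ball z r := by
    intro w hw hw1
    refine ⟨⟨fun j => ?_, fun j => ?_⟩, ?_⟩
    · by_cases hj : j = i
      · subst hj
        have : 0 ≤ z j := hz.1 j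
        simpa using add_nonneg this hw.1
      · simpa [hj] using hz.1 j
    · by_cases hj : j = i
      · subst hj
        simpa using hw1
      · simpa [hj] using hz.2 j
    · rw [Metric.mem_ball]
      refine lt_of_le_of_lt ((dist_pi_le_iff (by positivity : 0 ≤ r / 2)).2 fun j => ?_)
        (by linarith : r / 2 < r)
      by_cases hj : j = i
      · subst hj
        simpa [Real.dist_eq, abs_of_nonneg hw.1] using hw.2
      · simpa [hj] using (half_pos hr).le
  have hconv : Convex ℝ (cube D ∩ Metric.ball z r) :=
    (convex_Icc _ _).inter (convex_ball _ _)
  have hmv := hconv.norm_image_sub_le_of_norm_hasFDerivWithin_le' (f := F₀)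
    (f' := fderivWithin ℝ F₀ (cube D)) (φ := L) (C := s / 2)
    (fun x hx => ((h.differentiableOn one_ne_zero x hx.1).hasFDerivWithinAt).mono
      Set.inter_subset_left)
    (fun x hx => by
      have := (hball hx.1 hx.2).le
      rwa [dist_eq_norm] at this) (hmem v hv hv1) (hmem u hu hu1)
  have hsub : Function.update z i (z i + u) - Function.update z i (z i + v) =
      (u - v) • (Pi.single i 1 : Fin D → ℝ) := by
    ext j
    by_cases hj : j = i
    · subst hj; simp
    · simp [hj]
  rw [hsub, map_smul, norm_smul, Pi.norm_single, norm_one, mul_one, Real.norm_eq_abs,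
    Real.norm_eq_abs, smul_eq_mul] at hmv
  have h1 : |(u - v) * L (Pi.single i 1)| = |u - v| * s := abs_mul _ _
  have h2 := abs_sub_abs_le_abs_sub ((u - v) * L (Pi.single i 1))
    (F₀ (Function.update z i (z i + u)) - F₀ (Function.update z i (z i + v)))
  rw [abs_sub_comm ((u - v) * L (Pi.single i 1))] at h2
  linarith

/-- Points near the minimizer of each `f i` at which `f i` takes prescribed values and the other
components stay away from their minimal values. -/
lemma exists_level_points {d D : ℕ} (hD : 2 ≤ D) {f : Fin D → (Fin d → ℝ) → ℝ}
    {xmin : Fin D → Fin d → ℝ} (hf : ∀ i, ContinuousOn (f i) (cube d)) (hx : ∀ i, xmin i ∈ cube d)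
    (hmin : ∀ i, ∀ y ∈ cube d, y ≠ xmin i → f i (xmin i) < f i y)
    (hinj : Function.Injective xmin) :
    ∃ ρ > 0, ∀ i, ∀ u ∈ Set.Icc 0 ρ, ∃ y ∈ cube d, f i y = f i (xmin i) + u ∧
      ∀ j ≠ i, f j (xmin j) + ρ ≤ f j y := by
  have main : ∀ i, ∃ ρ > 0, ∀ u ∈ Set.Icc 0 ρ, ∃ y ∈ cube d, f i y = f i (xmin i) + u ∧
      ∀ j ≠ i, f j (xmin j) + ρ ≤ f j y := by
    intro i
    obtain ⟨i', hi'⟩ : ∃ i', i' ≠ i := by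
      have : Nontrivial (Fin D) := Fin.nontrivial_iff_two_le.2 hD
      exact exists_ne i
    -- On a short initial piece of a segment towards another minimizer, `f i` takes all slightly
    -- larger values by the intermediate value theorem, and the other components stay above their
    -- minima by continuity.
    set g : ℝ → Fin d → ℝ := fun r => AffineMap.lineMap (xmin i) (xmin i') r with hg
    have hgc : Continuous g := AffineMap.lineMap_continuous
    have hg0 : g 0 = xmin i := by simp [hg]
    have hgm : ∀ r ∈ Set.Icc (0 : ℝ) 1, g r ∈ cube d := fun r hr =>
      (convex_Icc _ _).lineMap_mem (hx i) (hx i') hr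
    have hfg : ∀ j, ContinuousOn (fun r => f j (g r)) (Set.Icc 0 1) := fun j =>
      (hf j).comp hgc.continuousOn hgm
    have hpos : ∀ j, j ≠ i → 0 < f j (xmin i) - f j (xmin j) := fun j hj =>
      sub_pos.2 (hmin j _ (hx i) fun h => hj (hinj h).symm)
    have hev : ∀ j, ∃ r₀ > 0, ∀ r ∈ Set.Icc (0 : ℝ) 1, r < r₀ → j ≠ i →
        f j (xmin j) + (f j (xmin i) - f j (xmin j)) / 2 ≤ f j (g r) := by
      intro j
      by_cases hj : j = i
      · exact ⟨1, one_pos, fun _ _ _ h => absurd hj h⟩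
      obtain ⟨r₀, hr₀, h⟩ := Metric.continuousOn_iff.1 (hfg j) 0 (by simp)
        ((f j (xmin i) - f j (xmin j)) / 2) (half_pos (hpos j hj))
      refine ⟨r₀, hr₀, fun r hr hrr _ => ?_⟩
      have h1 := h r hr (by rwa [Real.dist_eq, sub_zero, abs_of_nonneg hr.1])
      rw [Real.dist_eq, hg0, abs_lt] at h1
      linarith [h1.1]
    choose r₀ hr₀ hr₀' using hev
    have : Nonempty (Fin D) := ⟨i⟩
    obtain ⟨j₀, hj₀⟩ := Finite.exists_min r₀
    set r₁ := min (r₀ j₀ / 2) 1 with hr₁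
    have hr₁0 : 0 < r₁ := lt_min (half_pos (hr₀ j₀)) one_pos
    have hr₁1 : r₁ ≤ 1 := min_le_right _ _
    have hgr₁ : g r₁ ≠ xmin i := by
      intro h
      have h1 : r₁ • (xmin i' - xmin i) = 0 := by
        simpa [hg, AffineMap.lineMap_apply] using h
      rcases smul_eq_zero.1 h1 with h2 | h2
      · exact hr₁0.ne' h2
      · exact hi' (hinj (sub_eq_zero.1 h2))
    have htop : f i (xmin i) < f i (g r₁) := hmin i _ (hgm _ ⟨hr₁0.le, hr₁1⟩) hgr₁
    obtain ⟨j₁, hj₁⟩ := Finite.exists_min fun j =>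
      if j = i then f i (g r₁) - f i (xmin i) else (f j (xmin i) - f j (xmin j)) / 2
    set ρ := if j₁ = i then f i (g r₁) - f i (xmin i) else (f j₁ (xmin i) - f j₁ (xmin j₁)) / 2
    have hρ : 0 < ρ := by
      simp only [ρ]
      split_ifs with h
      · exact sub_pos.2 htop
      · exact half_pos (hpos _ h)
    refine ⟨ρ, hρ, fun u hu => ?_⟩
    have hρi : ρ ≤ f i (g r₁) - f i (xmin i) := by simpa using hj₁ i
    obtain ⟨r, hr, hru⟩ := intermediate_value_Icc hr₁0.le
      ((hfg i).mono (Set.Icc_subset_Icc_right hr₁1))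
      (show f i (xmin i) + u ∈ Set.Icc (f i (g 0)) (f i (g r₁)) by
        rw [hg0]; exact ⟨by linarith [hu.1], by linarith [hu.2]⟩)
    have hr1 : r ∈ Set.Icc (0 : ℝ) 1 := ⟨hr.1, hr.2.trans hr₁1⟩
    refine ⟨g r, hgm r hr1, hru, fun j hj => ?_⟩
    have h1 : ρ ≤ (f j (xmin i) - f j (xmin j)) / 2 := by simpa [hj] using hj₁ j
    have h2 := hr₀' j r hr1 (by
      have := hj₀ j
      have := hr₀ j₀
      have := min_le_left (r₀ j₀ / 2) 1
      linarith [hr.2]) hj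
    linarith
  choose ρ hρ h using main
  have : Nonempty (Fin D) := ⟨⟨0, by omega⟩⟩
  obtain ⟨i₀, hi₀⟩ := Finite.exists_min ρ
  refine ⟨ρ i₀, hρ i₀, fun i u hu => ?_⟩
  obtain ⟨y, hy, h1, h2⟩ := h i u ⟨hu.1, hu.2.trans (hi₀ i)⟩
  exact ⟨y, hy, h1, fun j hj => by linarith [h2 j hj, hi₀ i]⟩

/-! ### Selection of positions, pigeonhole, and stability of softmax averages. -/

/-- For finitely many scores one can fix the tokens at as many positions in such a way that for
every score one of them dominates all tokens at the remaining positions. -/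
lemma exists_dominating {J K : Type} [Finite K] [Nonempty K] {T : ℕ} (hT : 1 ≤ T)
    (sc : J → Fin T → K → ℝ) (s : Finset J) :
    ∃ (U : Finset (Fin T)) (κ : Fin T → K), U.card ≤ s.card ∧
      ∀ j ∈ s, ∃ u ∈ U, ∀ t ∉ U, ∀ k, sc j t k ≤ sc j u (κ u) := by
  classical
  induction s using Finset.induction_on with
  | empty => exact ⟨∅, fun _ => Classical.arbitrary K, by simp, by simp⟩
  | insert j s hj ih =>
    obtain ⟨U, κ, hU, h⟩ := ih
    rw [Finset.card_insert_of_notMem hj]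
    by_cases hfull : U = Finset.univ
    · refine ⟨U, κ, by omega, fun j' _ => ⟨⟨0, hT⟩, by simp [hfull], fun t ht => ?_⟩⟩
      simp [hfull] at ht
    · obtain ⟨t', ht'⟩ : ∃ t, t ∉ U := by
        by_contra! hcon
        exact hfull (Finset.eq_univ_iff_forall.2 hcon)
      have : Nonempty {t // t ∉ U} := ⟨⟨t', ht'⟩⟩
      -- Greedy choice: the best token over all positions still free is frozen. Domination for the
      -- earlier scores persists, as the set of free positions only shrinks.
      obtain ⟨⟨⟨t₁, ht₁⟩, k₁⟩, hmax⟩ := Finite.exists_max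
        fun q : {t // t ∉ U} × K => sc j q.1 q.2
      refine ⟨insert t₁ U, Function.update κ t₁ k₁, (Finset.card_insert_le _ _).trans (by omega),
        fun j' hj' => ?_⟩
      rcases Finset.mem_insert.1 hj' with rfl | hj'
      · refine ⟨t₁, Finset.mem_insert_self _ _, fun t ht k => ?_⟩
        rw [Function.update_self]
        exact hmax (⟨t, fun h => ht (Finset.mem_insert_of_mem h)⟩, k)
      · obtain ⟨u, hu, hdom⟩ := h j' hj'
        refine ⟨u, Finset.mem_insert_of_mem hu, fun t ht k => ?_⟩
        rw [Function.update_of_ne (fun h : u = t₁ => ht₁ (h ▸ hu))]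
        exact hdom t (fun h => ht (Finset.mem_insert_of_mem h)) k

/-- Distinct representatives for sets of positions, avoiding a given set. -/
lemma exists_representatives {T D : ℕ} (S : Fin D → Finset (Fin T)) (U : Finset (Fin T))
    (i₀ : Fin D) (J : Finset (Fin D)) (h : ∀ i, U.card + J.card ≤ (S i).card) :
    ∃ (V : Finset (Fin T)) (ν : Fin T → Fin D), V.card ≤ J.card ∧
      (∀ t, ν t = i₀ ∨ ν t ∈ J) ∧ ∀ i ∈ J, ∃ t ∈ V, t ∉ U ∧ t ∈ S i ∧ ν t = i := by
  classical
  induction J using Finset.induction_on with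
  | empty => exact ⟨∅, fun _ => i₀, by simp, by simp, by simp⟩
  | insert i J hi ih =>
    rw [Finset.card_insert_of_notMem hi] at h
    obtain ⟨V, ν, hV, hν, hrep⟩ := ih fun i => (by omega : _ ≤ U.card + (J.card + 1)).trans (h i)
    obtain ⟨t, htS, ht⟩ := Finset.exists_mem_notMem_of_card_lt_card (s := U ∪ V) (t := S i)
      (lt_of_le_of_lt (Finset.card_union_le _ _) (by have := h i; omega))
    rw [Finset.mem_union, not_or] at ht
    refine ⟨insert t V, Function.update ν t i, ?_, fun t' => ?_, fun i' hi' => ?_⟩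
    · rw [Finset.card_insert_of_notMem hi]
      exact (Finset.card_insert_le _ _).trans (by omega)
    · by_cases h' : t' = t
      · subst h'; simp
      · rw [Function.update_of_ne h']
        exact (hν t').imp id Finset.mem_insert_of_mem
    · rcases Finset.mem_insert.1 hi' with rfl | hi'
      · exact ⟨t, Finset.mem_insert_self _ _, ht.1, htS, by simp⟩
      · obtain ⟨t', h1, h2, h3, h4⟩ := hrep i' hi'
        refine ⟨t', Finset.mem_insert_of_mem h1, h2, h3, ?_⟩
        rwa [Function.update_of_ne (fun h : t' = t => ht.2 (h ▸ h1))]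

/-- The pigeonhole principle for real vectors in a box. -/
lemma exists_ne_close {α κ : Type*} [Fintype α] [Fintype κ] (Φ : α → κ → ℝ) {R : ℝ} (hR : 0 < R)
    (hΦ : ∀ a k, |Φ a k| ≤ R) {B : ℕ} (hB : 1 ≤ B) (hcard : B ^ Fintype.card κ < Fintype.card α) :
    ∃ a b, a ≠ b ∧ ∀ k, |Φ a k - Φ b k| ≤ 2 * R / B := by
  classical
  have hB0 : (0 : ℝ) < B := by exact_mod_cast hB
  let y : α → κ → ℝ := fun a k => (Φ a k + R) * B / (2 * R)
  -- The truncation at `B - 1` puts the right endpoint of the range into the last cell.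
  let cell : α → κ → Fin B := fun a k => ⟨min ⌊y a k⌋₊ (B - 1), by omega⟩
  obtain ⟨a, b, hab, hcell⟩ := Fintype.exists_ne_map_eq_of_card_lt cell (by simpa using hcard)
  have hy0 : ∀ a k, 0 ≤ y a k := fun a k =>
    div_nonneg (mul_nonneg (by linarith [(abs_le.1 (hΦ a k)).1]) hB0.le) (by positivity)
  have hyB : ∀ a k, y a k ≤ B := fun a k => by
    rw [div_le_iff₀ (by positivity)]
    nlinarith [(abs_le.1 (hΦ a k)).2]
  have hlow : ∀ a k, ((cell a k : ℕ) : ℝ) ≤ y a k := fun a k =>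
    (Nat.cast_le.2 (min_le_left _ _)).trans (Nat.floor_le (hy0 a k))
  have hup : ∀ a k, y a k ≤ (cell a k : ℕ) + 1 := fun a k => by
    rcases le_total ⌊y a k⌋₊ (B - 1) with h | h
    · simp only [cell, min_eq_left h]
      exact (Nat.lt_floor_add_one _).le
    · simp only [cell, min_eq_right h]
      have : ((B - 1 : ℕ) : ℝ) + 1 = B := by exact_mod_cast (by omega : B - 1 + 1 = B)
      rw [this]
      exact hyB a k
  refine ⟨a, b, hab, fun k => ?_⟩
  have h1 := hlow a k
  have h2 := hup a k
  rw [congrFun hcell k] at h1 h2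
  have h3 : |y a k - y b k| ≤ 1 := by
    rw [abs_le]
    constructor <;> linarith [hlow b k, hup b k]
  have h4 : y a k - y b k = (Φ a k - Φ b k) * (B / (2 * R)) := by
    simp only [y]; ring
  rw [h4, abs_mul, abs_of_pos (by positivity : 0 < B / (2 * R)), ← le_div_iff₀ (by positivity),
    one_div_div] at h3
  exact h3

/-- Softmax averages are close if the unnormalized sums are close and one weight dominates. -/
lemma abs_softmax_average_sub_le {T : ℕ} {β m R η : ℝ} (ρ ρ' v v' : Fin T → ℝ) (hR : 0 ≤ R)
    (hv' : ∀ t, |v' t| ≤ R) {u : Fin T} (hu : ρ u = m)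
    (hS : |∑ t, Real.exp (β * (ρ t - m)) - ∑ t, Real.exp (β * (ρ' t - m))| ≤ η)
    (hN : |∑ t, Real.exp (β * (ρ t - m)) * v t - ∑ t, Real.exp (β * (ρ' t - m)) * v' t| ≤ η) :
    |∑ t, softmax β ρ t * v t - ∑ t, softmax β ρ' t * v' t| ≤ η * (1 + R) := by
  have hform : ∀ ρ v : Fin T → ℝ, ∑ t, softmax β ρ t * v t =
      (∑ t, Real.exp (β * (ρ t - m)) * v t) / ∑ t, Real.exp (β * (ρ t - m)) := by
    intro ρ v
    have h1 : ∀ t, Real.exp (β * (ρ t - m)) = Real.exp (β * ρ t) * Real.exp (-(β * m)) := by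
      intro t; rw [← Real.exp_add]; ring_nf
    simp only [softmax, h1, ← Finset.sum_mul]
    rw [Finset.sum_div]
    refine Finset.sum_congr rfl fun t _ => ?_
    rw [mul_right_comm, mul_div_mul_right _ _ (Real.exp_pos _).ne', div_mul_eq_mul_div]
  rw [hform ρ v, hform ρ' v']
  set A := ∑ t, Real.exp (β * (ρ t - m)) with hA
  set A' := ∑ t, Real.exp (β * (ρ' t - m)) with hA'
  set N := ∑ t, Real.exp (β * (ρ t - m)) * v t
  set N' := ∑ t, Real.exp (β * (ρ' t - m)) * v' t with hN'
  -- The position `u` contributes `exp 0 = 1`. This keeps the division by the normalizer from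
  -- amplifying the error.
  have hA1 : 1 ≤ A := by
    have := Finset.single_le_sum (f := fun t => Real.exp (β * (ρ t - m)))
      (fun t _ => (Real.exp_pos _).le) (Finset.mem_univ u)
    simpa [hu] using this
  have hA'0 : 0 < A' := Finset.sum_pos (fun t _ => Real.exp_pos _) ⟨u, Finset.mem_univ _⟩
  have hN'R : |N'| ≤ R * A' := by
    rw [hN', hA', Finset.mul_sum]
    refine (Finset.abs_sum_le_sum_abs _ _).trans (Finset.sum_le_sum fun t _ => ?_)
    rw [abs_mul, abs_of_pos (Real.exp_pos _), mul_comm]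
    exact mul_le_mul_of_nonneg_right (hv' t) (Real.exp_pos _).le
  have hη : 0 ≤ η := (abs_nonneg _).trans hS
  have hA0 : 0 < A := by linarith
  have e : N / A - N' / A' = ((N - N') - N' / A' * (A - A')) / A := by
    field_simp
    ring
  have h2 : |N' / A'| ≤ R := by
    rw [abs_div, abs_of_pos hA'0, div_le_iff₀ hA'0]; exact hN'R
  rw [e, abs_div, abs_of_pos hA0, div_le_iff₀ hA0]
  calc |N - N' - N' / A' * (A - A')| ≤ |N - N'| + |N' / A' * (A - A')| := abs_sub _ _
    _ ≤ η + R * η := by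
        rw [abs_mul]
        gcongr
    _ = η * (1 + R) * 1 := by ring
    _ ≤ η * (1 + R) * A := by gcongr

/-- A two-layer network with weights bounded by one is Lipschitz in the sup norm, with its parameter
count as constant. -/
lemma FFN.abs_eval_sub_le {m : ℕ} {τ : ℝ → ℝ} (hτ : LipschitzWith 1 τ) (G : FFN 1 2 m)
    (hG : G.WeightsIn unitWeights) {y y' : Fin m → ℝ} {c : ℝ} (hc : 0 ≤ c)
    (hy : ∀ q, |y q - y' q| ≤ c) :
    |G.eval τ y 0 - G.eval τ y' 0| ≤ G.paramCount * c := by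
  classical
  obtain ⟨p, A, b, A', b', rfl⟩ := G.exists_eq_layer_output
  obtain ⟨⟨hA, hb⟩, hA', hb'⟩ := hG
  have hcount : (Set.ncard {q : Fin p × Fin m | A q.1 q.2 ≠ 0} : ℝ) ≤
      ((FFN.layer A b (.output A' b')).paramCount : ℕ) := by
    simp only [FFN.paramCount, nonzeroCount]
    exact_mod_cast (by omega)
  refine le_trans ?_ (mul_le_mul_of_nonneg_right hcount hc)
  have hone : ∀ x ∈ unitWeights, |x| ≤ 1 := fun x hx => abs_le.2 hx
  simp only [FFN.eval, Matrix.mulVec, dotProduct, Pi.add_apply, add_sub_add_right_eq_sub,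
    ← Finset.sum_sub_distrib, ← mul_sub]
  calc _ ≤ ∑ r, |A' 0 r * (τ (∑ j, A r j * y j + b r) - τ (∑ j, A r j * y' j + b r))| :=
        Finset.abs_sum_le_sum_abs _ _
    _ ≤ ∑ r, ∑ j, if A r j ≠ 0 then c else 0 := by
        refine Finset.sum_le_sum fun r _ => ?_
        rw [abs_mul]
        refine (mul_le_of_le_one_left (abs_nonneg _) (hone _ (hA' 0 r))).trans
          ((abs_sub_le_of_lipschitz hτ _ _).trans ?_)
        rw [add_sub_add_right_eq_sub, ← Finset.sum_sub_distrib]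
        refine (Finset.abs_sum_le_sum_abs _ _).trans (Finset.sum_le_sum fun j _ => ?_)
        rw [← mul_sub, abs_mul]
        split_ifs with h
        · exact (mul_le_of_le_one_left (abs_nonneg _) (hone _ (hA r j))).trans (hy j)
        · simp [not_not.1 h]
    _ = _ := by
        rw [← Fintype.sum_prod_type' (f := fun r j => if A r j ≠ 0 then c else 0),
          ← Finset.sum_filter, Finset.sum_const, nsmul_eq_mul, Set.ncard_eq_toFinset_card']
        congr 3
        ext q
        simp


lemma iInf_eq_of_forall_le {T : ℕ} {S : Finset (Fin T)} {v : Fin T → ℝ} {a : ℝ}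
    (h : ∀ t ∈ S, a ≤ v t) (h' : ∃ t ∈ S, v t = a) : ⨅ t : {t // t ∈ S}, v t = a := by
  obtain ⟨t, ht, hta⟩ := h'
  obtain ⟨h1, u, hu, hua⟩ := iInf_mem_eq v ⟨t, ht⟩
  exact le_antisymm (hta ▸ h1 t ht) (hua ▸ h u hu)

/-! ### Confused inputs and the parameter lower bound. -/

/-- Two inputs on which `s < D` softmax averages of bounded values nearly agree although the values
of the target differ. -/
lemma exists_confused_inputs {d T D s n : ℕ} (hT : 1 ≤ T) (hsD : s < D) (hs : 1 ≤ s)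
    {F₀ : (Fin D → ℝ) → ℝ} {f : Fin D → (Fin d → ℝ) → ℝ} {S : Fin D → Finset (Fin T)}
    {xmin : Fin D → Fin d → ℝ} (htask : IsRetrievalTask F₀ f S xmin)
    {κ ρ : ℝ} (hκ : 0 < κ) (hρ : 0 < ρ)
    (hslope : ∀ i, ∀ u v : ℝ, u ∈ Set.Icc 0 ρ → v ∈ Set.Icc 0 ρ → f i (xmin i) + u ≤ 1 →
      f i (xmin i) + v ≤ 1 → κ * |u - v| ≤
        |F₀ (Function.update (fun j => f j (xmin j)) i (f i (xmin i) + u)) -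
          F₀ (Function.update (fun j => f j (xmin j)) i (f i (xmin i) + v))|)
    (hpts : ∀ i, ∀ u ∈ Set.Icc 0 ρ, ∃ y ∈ cube d, f i y = f i (xmin i) + u ∧
      ∀ j ≠ i, f j (xmin j) + ρ ≤ f j y)
    {Δ : ℝ} (hΔ : 0 < Δ) {q B : ℕ} (hq : 1 ≤ q) (hB : 1 ≤ B) (hΔq : Δ * (T * q) ≤ ρ)
    (hm : 0 < (T : ℝ) / 4 - s - D + 1)
    (hcard : ∀ N : ℕ, (T : ℝ) / 4 - s - D + 1 ≤ N → B ^ (s * (n + 1)) < q ^ N)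
    (sc : Fin s → Fin T → (Fin d → ℝ) → ℝ) (val : Fin s → Fin n → Fin T → (Fin d → ℝ) → ℝ)
    {R β : ℝ} (hR : 1 ≤ R) (hβ : 0 < β) (hval : ∀ j r t, ∀ x ∈ cube d, |val j r t x| ≤ R) :
    ∃ X ∈ inputSpace d T, ∃ X' ∈ inputSpace d T,
      κ * Δ ≤ |retrievalTarget F₀ f S X - retrievalTarget F₀ f S X'| ∧
      ∀ j r, |∑ t, softmax β (fun t => sc j t (X t)) t * val j r t (X t) -
        ∑ t, softmax β (fun t => sc j t (X' t)) t * val j r t (X' t)| ≤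
          2 * (T * R) / B * (1 + R) := by
  classical
  have hT0 : (0 : ℝ) < T := by exact_mod_cast hT
  have hρ0 : (0 : ℝ) ∈ Set.Icc 0 ρ := ⟨le_rfl, hρ.le⟩
  choose! pt hptm hptf hptj using hpts
  -- Levels are indexed by position as well as by `Fin q`, so different positions never share a
  -- level.
  set lev : Fin T × Fin q → ℝ := fun k => Δ * (finProdFinEquiv k : ℕ) with hlev
  have hlevm : ∀ k, lev k ∈ Set.Icc 0 ρ := by
    intro k
    refine ⟨by positivity, le_trans ?_ hΔq⟩
    have : ((finProdFinEquiv k : ℕ) : ℝ) ≤ T * q := by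
      exact_mod_cast (finProdFinEquiv k).2.le
    exact mul_le_mul_of_nonneg_left this hΔ.le
  have hlevne : ∀ k k', k ≠ k' → Δ ≤ |lev k - lev k'| := by
    intro k k' hkk
    have hne : ((finProdFinEquiv k : ℕ) : ℤ) - (finProdFinEquiv k' : ℕ) ≠ 0 := by
      rw [sub_ne_zero]
      intro h
      exact hkk (finProdFinEquiv.injective (Fin.ext (by exact_mod_cast h)))
    have h4 : (1 : ℝ) ≤ |((finProdFinEquiv k : ℕ) : ℝ) - (finProdFinEquiv k' : ℕ)| := by
      exact_mod_cast Int.one_le_abs hne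
    simp only [hlev]
    rw [← mul_sub, abs_mul, abs_of_pos hΔ]
    exact le_mul_of_one_le_right hΔ.le h4
  let tok : Fin D × (Fin T × Fin q) → Fin d → ℝ := fun k => pt k.1 (lev k.2)
  have : Nonempty (Fin D × (Fin T × Fin q)) := ⟨⟨⟨0, by omega⟩, ⟨0, hT⟩, ⟨0, hq⟩⟩⟩
  obtain ⟨U, κ', hU, hdom⟩ := exists_dominating hT (fun j t k => sc j t (tok k))
    (Finset.univ : Finset (Fin s))
  rw [Finset.card_univ, Fintype.card_fin] at hU
  -- At most `s < D` components occur among the frozen tokens, so one is left over.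
  obtain ⟨i₁, -, hi₁⟩ : ∃ i ∈ (Finset.univ : Finset (Fin D)), i ∉ U.image fun t => (κ' t).1 :=
    Finset.exists_mem_notMem_of_card_lt_card
      (Finset.card_image_le.trans_lt (by simpa using hU.trans_lt hsD))
  have hκi₁ : ∀ t ∈ U, i₁ ≠ (κ' t).1 := fun t ht h =>
    hi₁ (Finset.mem_image.2 ⟨t, ht, h.symm⟩)
  -- Default component for positions without an assigned role; being different from `i₁`, it keeps
  -- `f i₁` at least `ρ` above its minimum there.
  obtain ⟨i₀, hi₀⟩ : ∃ i : Fin D, i ≠ i₁ := by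
    have : Nontrivial (Fin D) := Fin.nontrivial_iff_two_le.2 (by omega)
    exact exists_ne i₁
  have hJ : (Finset.univ.erase i₁ : Finset (Fin D)).card = D - 1 := by simp
  have hScard : ∀ i, s + D ≤ (S i).card := by
    intro i
    have h1 := htask.quarter_le_card i
    have h2 : ((s + D : ℕ) : ℝ) < ((S i).card + 1 : ℕ) := by push_cast; linarith
    have : s + D < (S i).card + 1 := by exact_mod_cast h2
    omega
  obtain ⟨V, ν, hV, hν, hrep⟩ := exists_representatives S U i₀ (Finset.univ.erase i₁)
    (fun i => by rw [hJ]; have := hScard i; omega)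
  have hνi₁ : ∀ t, i₁ ≠ ν t := fun t h => by
    rcases hν t with h' | h'
    · exact hi₀ (h' ▸ h.symm)
    · exact Finset.ne_of_mem_erase h' h.symm
  let X₀ : Fin T → Fin d → ℝ := fun t => if t ∈ U then tok (κ' t) else pt (ν t) 0
  have hX₀m : ∀ t, X₀ t ∈ cube d := fun t => by
    simp only [X₀]
    split_ifs
    · exact hptm _ _ (hlevm _)
    · exact hptm _ _ hρ0
  have hX₀f : ∀ t, f i₁ (xmin i₁) + ρ ≤ f i₁ (X₀ t) := fun t => by
    simp only [X₀]
    split_ifs with h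
    · exact hptj _ _ (hlevm _) _ (hκi₁ t h)
    · exact hptj _ _ hρ0 _ (hνi₁ t)
  set A : Finset (Fin T) := S i₁ \ (U ∪ V) with hA
  have hAcard : (T : ℝ) / 4 - s - D + 1 ≤ A.card := by
    have h1 := htask.quarter_le_card i₁
    have h2 : (S i₁).card ≤ A.card + (U.card + V.card) :=
      (Finset.card_le_card_sdiff_add_card (s := S i₁) (t := U ∪ V)).trans
        (Nat.add_le_add_left (Finset.card_union_le _ _) _)
    have h3 : (S i₁).card + 1 ≤ A.card + (s + D) := by rw [hJ] at hV; omega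
    have h4 : ((S i₁).card : ℝ) + 1 ≤ A.card + (s + D) := by exact_mod_cast h3
    linarith
  let ext : (A → Fin q) → Fin T → Fin q := fun c t => if h : t ∈ A then c ⟨t, h⟩ else ⟨0, hq⟩
  choose u huU hu using fun j => hdom j (Finset.mem_univ j)
  let p : (A → Fin q) → Fin T → Fin d → ℝ := fun c t => pt i₁ (lev (t, ext c t))
  have hpm : ∀ c t, p c t ∈ cube d := fun c t => hptm _ _ (hlevm _)
  let m : Fin s → ℝ := fun j => sc j (u j) (tok (κ' (u j)))
  -- The index `none` stands for the normalizer, `some r` for the `r`-th numerator. Domination makes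
  -- the exponential factor at most 1 at the free positions.
  let w : Fin s → Option (Fin n) → Fin T → (Fin d → ℝ) → ℝ := fun j o t x =>
    Real.exp (β * (sc j t x - m j)) * o.elim 1 fun r => val j r t x
  obtain ⟨c, c', hcc, hclose⟩ := exists_ne_close
    (fun (c : A → Fin q) (k : Fin s × Option (Fin n)) => ∑ t ∈ A, w k.1 k.2 t (p c t))
    (R := T * R) (by positivity) (fun c k => by
      refine (Finset.abs_sum_le_sum_abs _ _).trans ?_
      have h1 : ∀ t ∈ A, |w k.1 k.2 t (p c t)| ≤ R := by
        intro t ht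
        have htU : t ∉ U := fun h =>
          (Finset.mem_sdiff.1 ht).2 (Finset.mem_union_left _ h)
        have h2 : Real.exp (β * (sc k.1 t (p c t) - m k.1)) ≤ 1 := by
          rw [Real.exp_le_one_iff]
          exact mul_nonpos_of_nonneg_of_nonpos hβ.le
            (sub_nonpos.2 (hu k.1 t htU (i₁, (t, ext c t))))
        have h3 : |k.2.elim 1 fun r => val k.1 r t (p c t)| ≤ R := by
          rcases k with ⟨j, _ | r⟩
          · simpa using hR
          · exact hval _ _ _ _ (hpm _ _)
        simp only [w]
        rw [abs_mul, abs_of_pos (Real.exp_pos _)]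
        exact (mul_le_of_le_one_left (abs_nonneg _) h2).trans h3
      refine (Finset.sum_le_card_nsmul _ _ _ h1).trans ?_
      rw [nsmul_eq_mul]
      gcongr
      exact_mod_cast (Finset.card_le_univ A).trans_eq (by simp)) hB (by
      rw [Fintype.card_fun, Fintype.card_prod, Fintype.card_option, Fintype.card_fin,
        Fintype.card_fin, Fintype.card_fin, Fintype.card_coe]
      exact hcard _ hAcard)
  -- Positions where the two configurations agree are reset to the background `X₀`. The differences
  -- of the sums do not change, but the coordinates that could hide the difference of the minima are
  -- removed.
  set C : Finset (Fin T) := A.filter fun t => ext c t ≠ ext c' t with hC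
  have hCne : C.Nonempty := by
    obtain ⟨⟨t, ht⟩, hne⟩ := Function.ne_iff.1 hcc
    exact ⟨t, Finset.mem_filter.2 ⟨ht, by simpa [ext, ht] using hne⟩⟩
  have hCA : C ⊆ A := Finset.filter_subset _ _
  let Y : (A → Fin q) → Fin T → Fin d → ℝ := fun c t => if t ∈ C then p c t else X₀ t
  have hYm : ∀ c t, Y c t ∈ cube d := fun c t => by
    simp only [Y]
    split_ifs
    exacts [hpm _ _, hX₀m _]
  have hYsum : ∀ g : Fin T → (Fin d → ℝ) → ℝ, ∑ t, g t (Y c t) - ∑ t, g t (Y c' t) =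
      ∑ t ∈ A, g t (p c t) - ∑ t ∈ A, g t (p c' t) := by
    intro g
    rw [← Finset.sum_sub_distrib, ← Finset.sum_sub_distrib]
    refine (Finset.sum_subset_zero_on_sdiff (Finset.subset_univ A) (fun t ht => ?_)
      fun t ht => ?_).symm
    · have htC : t ∉ C := fun h => (Finset.mem_sdiff.1 ht).2 (hCA h)
      simp [Y, htC]
    · by_cases h : ext c t = ext c' t
      · have htC : t ∉ C := fun h' => (Finset.mem_filter.1 h').2 h
        simp [Y, htC, p, h]
      · have htC : t ∈ C := Finset.mem_filter.2 ⟨ht, h⟩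
        simp [Y, htC]
  -- On `C` the excess of `f i₁` is a level, at most `ρ`; elsewhere it is at least `ρ`. The other
  -- components attain their minima at the representatives in `V`, which are disjoint from `C`.
  have hF : ∀ c : A → Fin q, ∃ t ∈ C, retrievalTarget F₀ f S (Y c) =
      F₀ (Function.update (fun j => f j (xmin j)) i₁ (f i₁ (xmin i₁) + lev (t, ext c t))) := by
    intro c
    obtain ⟨t₀, ht₀, hmin⟩ := Finset.exists_min_image C (fun t => lev (t, ext c t)) hCne
    refine ⟨t₀, ht₀, ?_⟩
    rw [retrievalTarget]
    congr 1
    ext i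
    by_cases hi : i = i₁
    · subst hi
      rw [Function.update_self]
      refine iInf_eq_of_forall_le (v := fun t => f i (Y c t)) (fun t _ => ?_)
        ⟨t₀, (Finset.mem_sdiff.1 (hCA ht₀)).1, ?_⟩
      · by_cases ht : t ∈ C
        · simp only [Y, ht, if_true, p, hptf _ _ (hlevm _)]
          exact add_le_add_right (hmin t ht) _
        · simp only [Y, ht, if_false]
          linarith [hX₀f t, (hlevm (t₀, ext c t₀)).2]
      · simp only [Y, ht₀, if_true, p, hptf _ _ (hlevm _)]
    · rw [Function.update_of_ne hi]
      obtain ⟨t, htV, htU, htS, htν⟩ := hrep i (Finset.mem_erase.2 ⟨hi, Finset.mem_univ _⟩)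
      refine iInf_eq_of_forall_le (v := fun t => f i (Y c t)) (fun t _ => ?_) ⟨t, htS, ?_⟩
      · by_cases h : Y c t = xmin i
        · rw [h]
        · exact (htask.unique_min i _ (hYm c t) h).le
      · have htC : t ∉ C := fun h =>
          (Finset.mem_sdiff.1 (hCA h)).2 (Finset.mem_union_right _ htV)
        simp only [Y, htC, if_false, X₀, htU, htν, hptf _ _ hρ0, add_zero]
  refine ⟨Y c, hYm c, Y c', hYm c', ?_, fun j r => ?_⟩
  · obtain ⟨t, ht, h1⟩ := hF c
    obtain ⟨t', ht', h2⟩ := hF c'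
    rw [h1, h2]
    -- Equality would force the same position in `C` with the same level in both configurations,
    -- against the definition of `C`.
    have hne : (t, ext c t) ≠ (t', ext c' t') := by
      intro h
      rw [Prod.mk.injEq] at h
      obtain ⟨rfl, h⟩ := h
      exact (Finset.mem_filter.1 ht).2 h
    have hle : ∀ k, f i₁ (xmin i₁) + lev k ≤ 1 := fun k => by
      rw [← hptf i₁ _ (hlevm k)]
      exact (htask.mapsTo_comp i₁ (hptm i₁ _ (hlevm k))).2
    refine le_trans ?_ (hslope i₁ _ _ (hlevm _) (hlevm _) (hle _) (hle _))
    exact mul_le_mul_of_nonneg_left (hlevne _ _ hne) hκ.le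
  · refine abs_softmax_average_sub_le (m := m j) (u := u j) _ _ _ _ (by linarith)
      (fun t => hval _ _ _ _ (hYm _ _)) ?_ ?_ ?_
    · have huC : u j ∉ C := fun h =>
        (Finset.mem_sdiff.1 (hCA h)).2 (Finset.mem_union_left _ (huU j))
      simp only [Y, huC, if_false, X₀, huU j, if_true, m]
    · have h1 := hYsum fun t x => w j none t x
      have h2 := hclose (j, none)
      rw [← h1] at h2
      simpa [w] using h2
    · have h1 := hYsum fun t x => w j (some r) t x
      have h2 := hclose (j, some r)
      rw [← h1] at h2
      simpa [w] using h2

/-- A transformer with `s < D` heads that approximates a target well has many parameters. -/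
lemma le_param_mul {d T D s n ℓ M : ℕ} (hT : 1 ≤ T) (hsD : s < D) (hs : 1 ≤ s) (hn : 1 ≤ n)
    {F₀ : (Fin D → ℝ) → ℝ} {f : Fin D → (Fin d → ℝ) → ℝ} {S : Fin D → Finset (Fin T)}
    {xmin : Fin D → Fin d → ℝ} (htask : IsRetrievalTask F₀ f S xmin)
    {κ ρ : ℝ} (hκ : 0 < κ) (hρ : 0 < ρ)
    (hslope : ∀ i, ∀ u v : ℝ, u ∈ Set.Icc 0 ρ → v ∈ Set.Icc 0 ρ → f i (xmin i) + u ≤ 1 →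
      f i (xmin i) + v ≤ 1 → κ * |u - v| ≤
        |F₀ (Function.update (fun j => f j (xmin j)) i (f i (xmin i) + u)) -
          F₀ (Function.update (fun j => f j (xmin j)) i (f i (xmin i) + v))|)
    (hpts : ∀ i, ∀ u ∈ Set.Icc 0 ρ, ∃ y ∈ cube d, f i y = f i (xmin i) + u ∧
      ∀ j ≠ i, f j (xmin j) + ρ ≤ f j y)
    {Δ : ℝ} (hΔ : 0 < Δ) {q B : ℕ} (hq : 1 ≤ q) (hB : 1 ≤ B) (hΔq : Δ * (T * q) ≤ ρ)
    (hm : 0 < (T : ℝ) / 4 - s - D + 1)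
    (hcard : ∀ N : ℕ, (T : ℝ) / 4 - s - D + 1 ≤ N → B ^ (s * (n + 1)) < q ^ N)
    {H : (Fin T → Fin d → ℝ) → ℝ}
    (hH : H ∈ hypothesisClass lipschitzActivations ℓ 2 s n d T M) {η : ℝ}
    (hHF : ∀ X ∈ inputSpace d T, |H X - retrievalTarget F₀ f S X| ≤ η) :
    κ * Δ ≤ 2 * η + M * ((s * n : ℕ) * (2 * (T * (s * n : ℕ)) / B * (1 + (s * n : ℕ)))) := by
  obtain ⟨σ, hσ, τ, hτ, P, a, G, hP, ⟨hβ, -, -, hWV, hWO⟩, hG, hM, rfl⟩ := hH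
  set R : ℝ := ((s * n : ℕ) : ℝ) with hR
  have hR1 : 1 ≤ R := by rw [hR]; exact_mod_cast Nat.mul_pos hs hn
  set c : ℝ := 2 * (T * R) / B * (1 + R) with hc
  have hc0 : 0 ≤ c := by positivity
  -- The only property of the encoder that is needed.
  have henc : ∀ x ∈ cube d, ∀ t : Fin T, ∀ k, |encode σ P x t k| ≤ 1 := by
    intro x hx t k
    have h1 := hP x hx t
    rw [Real.sqrt_le_left zero_le_one, one_pow] at h1
    have h2 := Finset.single_le_sum (f := fun k => encode σ P x t k ^ 2)
      (fun k _ => sq_nonneg _) (Finset.mem_univ k)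
    exact (sq_le_one_iff_abs_le_one _).1 (h2.trans h1)
  obtain ⟨X, hX, X', hX', hsep, hclose⟩ := exists_confused_inputs (n := n) hT hsD hs htask hκ hρ
    hslope hpts hΔ hq hB hΔq hm hcard
    (fun j t x => (a.WQ j *ᵥ a.c₀) ⬝ᵥ (a.WK j *ᵥ encode σ P x t))
    (fun j r t x => (a.WV j *ᵥ encode σ P x t) r) hR1 hβ (fun j r t x hx => by
      simp only [Matrix.mulVec, dotProduct]
      refine (Finset.abs_sum_le_sum_abs _ _).trans ((Finset.sum_le_card_nsmul _ _ 1 fun k _ => ?_).trans_eq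
        (by simp [hR]))
      rw [abs_mul]
      exact mul_le_one₀ (hWV j r k) (abs_nonneg _) (henc x hx t k))
  have hout : ∀ k, |a.out (fun t => encode σ P (X t) t) k -
      a.out (fun t => encode σ P (X' t) t) k| ≤ R * c := by
    intro k
    simp only [Attention.out, Pi.add_apply, add_sub_add_left_eq_sub, Matrix.mulVec, dotProduct,
      ← Finset.sum_sub_distrib, ← mul_sub]
    refine (Finset.abs_sum_le_sum_abs _ _).trans ((Finset.sum_le_card_nsmul _ _ c fun k' _ => ?_).trans_eq
      (by simp [hR]))
    rw [abs_mul]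
    refine (mul_le_of_le_one_left (abs_nonneg _) (hWO k k')).trans ?_
    have := hclose (finProdFinEquiv.symm k').1 (finProdFinEquiv.symm k').2
    simpa only [Attention.concatHeads, Attention.head, Finset.sum_apply, Pi.smul_apply,
      smul_eq_mul] using this
  have hlip := G.abs_eval_sub_le hτ hG (by positivity) hout
  have hGM : (G.paramCount : ℝ) ≤ M := by exact_mod_cast (by omega : G.paramCount ≤ M)
  have hlip' := hlip.trans (mul_le_mul_of_nonneg_right hGM (by positivity))
  have h1 := abs_le.1 (hHF X hX)
  have h2 := abs_le.1 (hHF X' hX')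
  have h3 := abs_le.1 hlip'
  refine hsep.trans (abs_le.2 ⟨?_, ?_⟩) <;> linarith

lemma exists_task_constants {d T D : ℕ} (hD : 2 ≤ D) {F₀ : (Fin D → ℝ) → ℝ}
    {f : Fin D → (Fin d → ℝ) → ℝ} {S : Fin D → Finset (Fin T)} {xmin : Fin D → Fin d → ℝ}
    (htask : IsRetrievalTask F₀ f S xmin) :
    ∃ κ > 0, ∃ ρ > 0,
      (∀ i, ∀ u v : ℝ, u ∈ Set.Icc 0 ρ → v ∈ Set.Icc 0 ρ → f i (xmin i) + u ≤ 1 →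
        f i (xmin i) + v ≤ 1 → κ * |u - v| ≤
        |F₀ (Function.update (fun j => f j (xmin j)) i (f i (xmin i) + u)) -
          F₀ (Function.update (fun j => f j (xmin j)) i (f i (xmin i) + v))|) ∧
      ∀ i, ∀ u ∈ Set.Icc 0 ρ, ∃ y ∈ cube d, f i y = f i (xmin i) + u ∧
        ∀ j ≠ i, f j (xmin j) + ρ ≤ f j y := by
  have hz : (fun j => f j (xmin j)) ∈ cube D :=
    ⟨fun j => (htask.mapsTo_comp j (htask.xmin_mem j)).1,
      fun j => (htask.mapsTo_comp j (htask.xmin_mem j)).2⟩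
  choose κ hκ ρ hρ hslope using fun i =>
    exists_slope htask.contDiffOn_outer hz i (htask.partial_ne_zero i)
  obtain ⟨ρ', hρ', hpts⟩ := exists_level_points hD (fun i => (htask.contDiffOn_comp i).continuousOn)
    htask.xmin_mem htask.unique_min htask.xmin_injective
  have : Nonempty (Fin D) := ⟨⟨0, by omega⟩⟩
  obtain ⟨i₁, hi₁⟩ := Finite.exists_min κ
  obtain ⟨i₂, hi₂⟩ := Finite.exists_min ρ
  refine ⟨κ i₁, hκ i₁, min (ρ i₂) ρ', lt_min (hρ i₂) hρ', fun i u v hu hv hu1 hv1 => ?_,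
    fun i u hu => ?_⟩
  · have hle : min (ρ i₂) ρ' ≤ ρ i := (min_le_left _ _).trans (hi₂ i)
    refine le_trans ?_ (hslope i u v ⟨hu.1, hu.2.trans hle⟩ ⟨hv.1, hv.2.trans hle⟩ hu1 hv1)
    exact mul_le_mul_of_nonneg_right (hi₁ i) (abs_nonneg _)
  · obtain ⟨y, hy, h1, h2⟩ := hpts i u ⟨hu.1, hu.2.trans (min_le_right _ _)⟩
    exact ⟨y, hy, h1, fun j hj => by linarith [h2 j hj, min_le_right (ρ i₂) ρ']⟩

/-- Balances the number `q` of levels, limited by `T * q * Δ ≤ ρ`, against the number `B` of cells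
per coordinate, limited by the pigeonhole condition. For `m ≤ 0` the exponent is negative and `M ≥
1` suffices. -/
theorem few_heads_lower_bound {d T D s n : ℕ} (hT : 1 ≤ T) (hs : 1 ≤ s) (hn : 1 ≤ n) (hsD : s < D)
    {𝓕 : Set ((Fin T → Fin d → ℝ) → ℝ)} (h𝓕 : 𝓕 ⊆ targetClass d T D) (hne : 𝓕.Nonempty) :
    ∃ c : ℝ, 0 < c ∧ ∃ ε₀ : ℝ, 0 < ε₀ ∧ ∀ ε : ℝ, 0 < ε → ε < ε₀ → ∀ ℓ M : ℕ, 1 ≤ M →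
      EpsApproximates (hypothesisClass lipschitzActivations ℓ 2 s n d T M) ε 𝓕 →
      c * (1 / ε) ^ (((T : ℝ) / 4 - s - D + 1) / (((n : ℝ) + 1) * s + 1) - 1) ≤ M := by
  have hw : (0 : ℝ) < ((n : ℝ) + 1) * s + 1 := by positivity
  set m : ℝ := (T : ℝ) / 4 - s - D + 1 with hmdef
  rcases le_or_gt m 0 with hm | hm
  · refine ⟨1, one_pos, 1, one_pos, fun ε hε hε1 ℓ M hM _ => ?_⟩
    rw [one_mul]
    refine le_trans ?_ (by exact_mod_cast hM : (1 : ℝ) ≤ M)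
    refine Real.rpow_le_one_of_one_le_of_nonpos ?_ ?_
    · rw [one_le_div hε]; exact hε1.le
    · linarith [div_nonpos_of_nonpos_of_nonneg hm hw.le]
  obtain ⟨F, hF⟩ := hne
  obtain ⟨F₀, f, S, xmin, htask, rfl⟩ := h𝓕 hF
  obtain ⟨κ, hκ, ρ, hρ, hslope, hpts⟩ := exists_task_constants (by omega) htask
  have hT0 : (0 : ℝ) < T := by exact_mod_cast hT
  set E : ℝ := ((s * n : ℕ) : ℝ) with hE
  have hE0 : 0 < E := by rw [hE]; exact_mod_cast Nat.mul_pos hs hn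
  -- The summand 1 in the denominator makes `e * (s * (n + 1)) < m` strict, as the pigeonhole
  -- principle requires for `B ≤ q ^ e`.
  set e : ℝ := m / (((n : ℝ) + 1) * s + 1) with he
  have he0 : 0 < e := div_pos hm hw
  -- With `Δ = 4 * ε / κ` and `q ≤ 2 * K / ε`, this value gives exactly `Δ * (T * q) ≤ ρ`.
  set K : ℝ := ρ * κ / (8 * T) with hK
  have hK0 : 0 < K := by positivity
  set Z : ℝ := E * (2 * (T * E) * (1 + E)) with hZ
  have hZ0 : 0 < Z := by positivity
  refine ⟨K ^ e / Z, by positivity, K / 2, by positivity, fun ε hε hεK ℓ M hM happ => ?_⟩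
  obtain ⟨H, hH, η, hη, hHF⟩ := happ _ hF
  set q : ℕ := ⌊2 * K / ε⌋₊ with hqdef
  have hq4 : 4 ≤ 2 * K / ε := by rw [le_div_iff₀ hε]; linarith
  have hqle : (q : ℝ) ≤ 2 * K / ε := Nat.floor_le (by positivity)
  have hqge : K / ε ≤ q := by
    have h1 := Nat.lt_floor_add_one (2 * K / ε)
    have h2 : 2 * K / ε = 2 * (K / ε) := by ring
    linarith
  have hq2 : (2 : ℝ) ≤ q := by
    refine le_trans ?_ hqge
    rw [le_div_iff₀ hε]; linarith
  set B : ℕ := ⌊(q : ℝ) ^ e⌋₊ with hBdef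
  have hqe1 : 1 ≤ (q : ℝ) ^ e := Real.one_le_rpow (by linarith) he0.le
  have hB1 : 1 ≤ B := Nat.le_floor (by simpa using hqe1)
  have hBle : (B : ℝ) ≤ (q : ℝ) ^ e := Nat.floor_le (by positivity)
  have hBge : (q : ℝ) ^ e ≤ 2 * B := by
    have h1 := Nat.lt_floor_add_one ((q : ℝ) ^ e)
    have h2 : (1 : ℝ) ≤ B := by exact_mod_cast hB1
    linarith
  have hcard : ∀ N : ℕ, m ≤ N → B ^ (s * (n + 1)) < q ^ N := by
    intro N hN
    have h1 : ((B ^ (s * (n + 1)) : ℕ) : ℝ) < ((q ^ N : ℕ) : ℝ) := by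
      push_cast
      calc (B : ℝ) ^ (s * (n + 1)) ≤ ((q : ℝ) ^ e) ^ (s * (n + 1)) := by gcongr
        _ = (q : ℝ) ^ (e * ((s * (n + 1) : ℕ) : ℝ)) := by
            rw [Real.rpow_mul (by positivity), Real.rpow_natCast]
        _ < (q : ℝ) ^ (N : ℝ) := by
            refine Real.rpow_lt_rpow_of_exponent_lt (by linarith) (lt_of_lt_of_le ?_ hN)
            rw [he, div_mul_eq_mul_div, div_lt_iff₀ hw]
            push_cast
            nlinarith
        _ = (q : ℝ) ^ N := Real.rpow_natCast _ _
    exact_mod_cast h1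
  have hΔq : 4 * ε / κ * (T * q) ≤ ρ := by
    calc 4 * ε / κ * (T * q) ≤ 4 * ε / κ * (T * (2 * K / ε)) := by gcongr
      _ = ρ := by rw [hK]; field_simp; ring
  have hmain := le_param_mul hT hsD hs hn htask hκ hρ hslope hpts
    (by positivity : 0 < 4 * ε / κ) (by exact_mod_cast (by linarith : (1 : ℝ) ≤ q)) hB1 hΔq hm hcard
    hH hHF
  have hB0 : (0 : ℝ) < B := by exact_mod_cast hB1
  -- The target gap is `κ * Δ = 4 * ε`; the two approximation errors consume less than `2 * ε`, and
  -- the feed-forward block must produce the rest.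
  have h1 : 2 * ε ≤ M * (Z / B) := by
    have h2 : κ * (4 * ε / κ) = 4 * ε := by field_simp
    have h3 : E * (2 * (T * E) / B * (1 + E)) = Z / B := by rw [hZ]; ring
    rw [h2, h3] at hmain
    linarith
  have h2 : 2 * ε * B ≤ M * Z := by
    rw [← mul_div_assoc, le_div_iff₀ hB0] at h1
    exact h1
  have h3 : (K / ε) ^ e ≤ (q : ℝ) ^ e := Real.rpow_le_rpow (by positivity) hqge he0.le
  have h4 : K ^ e * (1 / ε) ^ e ≤ 2 * B := by
    rw [← Real.mul_rpow hK0.le (by positivity), mul_one_div]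
    exact h3.trans hBge
  rw [Real.rpow_sub_one (by positivity), one_div ε, div_inv_eq_mul, ← one_div, div_mul_eq_mul_div,
    div_le_iff₀ hZ0]
  calc K ^ e * ((1 / ε) ^ e * ε) = K ^ e * (1 / ε) ^ e * ε := by ring
    _ ≤ 2 * B * ε := by gcongr
    _ ≤ M * Z := by linarith

end TransformerRates

theorem theorem2 (d T D : ℕ) (hd : 1 ≤ d) (hT : 1 ≤ T) (hD : 1 ≤ D) :
    -- (1) `D` heads of dimension `2`
    (∀ (C₁ γ₁ C₂ γ₂ : ℝ) (Λ : NNReal), 0 < C₁ → 0 < γ₁ → 0 < C₂ → 0 < γ₂ →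
      ∃ C : ℝ, 0 < C ∧ ∀ ε : ℝ, 0 < ε → ∀ M : ℕ, C / ε ^ max γ₁ γ₂ < M →
        TransformerRates.EpsApproximates
          (TransformerRates.hypothesisClass TransformerRates.lipschitzActivations 2 2 D 2 d T M) ε
          (TransformerRates.approxTargetClass TransformerRates.lipschitzActivations Set.univ
            d T D C₁ γ₁ C₂ γ₂ Λ)) ∧
    -- (2) fewer than `D` heads
    (∀ s n : ℕ, 1 ≤ s → 1 ≤ n → s < D →
      ∀ 𝓕 : Set ((Fin T → Fin d → ℝ) → ℝ), 𝓕 ⊆ TransformerRates.targetClass d T D → 𝓕.Nonempty →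
      ∃ c : ℝ, 0 < c ∧ ∃ ε₀ : ℝ, 0 < ε₀ ∧ ∀ ε : ℝ, 0 < ε → ε < ε₀ → ∀ ℓ M : ℕ, 1 ≤ M →
        TransformerRates.EpsApproximates
          (TransformerRates.hypothesisClass TransformerRates.lipschitzActivations ℓ 2 s n d T M) ε
          𝓕 →
        c * (1 / ε) ^ (((T : ℝ) / 4 - s - D + 1) / (((n : ℝ) + 1) * s + 1) - 1) ≤ M) ∧
    -- (3) one head of large dimension and a five-layer ReLU feed-forward block
    (∀ (C₁ γ₁ C₂ γ₂ : ℝ) (Λ : NNReal), 0 < C₁ → 0 < γ₁ → 0 < C₂ → 0 < γ₂ →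
      ∃ C : ℝ, 0 < C ∧ ∀ n : ℕ, T * d ≤ n → ∀ ε : ℝ, 0 < ε → ∀ M : ℕ,
        C / ε ^ (1 + max γ₁ γ₂) < M →
        TransformerRates.EpsApproximates
          (TransformerRates.hypothesisClass {TransformerRates.relu} 2 5 1 n d T M) ε
          (TransformerRates.approxTargetClass {TransformerRates.relu} TransformerRates.unitWeights
            d T D C₁ γ₁ C₂ γ₂ Λ)) := by
  refine ⟨fun C₁ γ₁ C₂ γ₂ Λ hC₁ hγ₁ hC₂ _ =>
      TransformerRates.multihead_upper_bound hT hD C₁ γ₁ C₂ γ₂ Λ hC₁ hγ₁ hC₂,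
    fun s n hs hn hsD 𝓕 h𝓕 hne => TransformerRates.few_heads_lower_bound hT hs hn hsD h𝓕 hne,
    fun C₁ γ₁ C₂ γ₂ Λ hC₁ hγ₁ hC₂ _ =>
      TransformerRates.single_head_upper_bound hd hT C₁ γ₁ C₂ γ₂ Λ hC₁ hγ₁ hC₂⟩
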